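/- Work over the field $\mathbb{Q}(q)$ of rational functions in an indeterminate $q$. **Rooted trees.** Let $\mathsf{PL}=\bigoplus_{n\ge 1}\mathsf{PL}_n$ be the free (right) pre-Lie algebra on one generator, realized on the vector space with basis the rooted trees, $\mathsf{PL}_n$ being spanned by the trees with $n$ vertices; the product $T\curvearrowleft T'$ is the sum of all trees obtained by adding an edge from the root of $T'$ to a vertex of $T$, and the generator is the one-vertex tree $\bullet$. Let $\widehat{\mathsf{PL}}=\prod_{n\ge1}\mathsf{PL}_n$. For $A,x\in\widehat{\mathsf{PL}}$ and a power series $f(z)=\sum_k f_kz^k$ put $x\curvearrowleft f(A)=\sum_k f_k\,((x\curvearrowleft A)\curvearrowleft\cdots)\curvearrowleft A$ ($k$ factors $A$ in the $k$-th term). Let $\Omega$ be the unique element of $\widehat{\mathsf{PL}}$ with $$\bullet\curvearrowleft\Big(\frac{\Omega}{\exp(\Omega)-1}\Big)=\Omega ,$$ and, writing $A[q]=\sum_n q^nA_n$ for $A=\sum_n A_n$, let $\Omega_q=\sum_{n\ge1}\Omega_{q,n}$ be the unique element of $\widehat{\mathsf{PL}}$ with $$\Omega_q[q]\curvearrowleft(\exp(\Omega)-1)+\Omega_q[q]-\Omega_q=\bullet\curvearrowleft\Omega_q+(q-1)\,\bullet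 .$$ The suspension of $A=\sum_n A_n$ is $\sum_{n\ge1}(-1)^{n-1}A_n$. **Planar binary trees.** Let $\operatorname{Dend}$ be the free dendriform algebra on one generator $Y$, realized on the vector space with basis the planar binary trees with at least one inner vertex, with $(l\vee r)\prec s=l\vee(r*s)$, $s\succ(l\vee r)=(s*l)\vee r$ and $x*y=x\succ y+x\prec y$; adjoin a unit $1$ for $*$. Let $L_0=1$, $L_1=Y$, $L_{n+1}=L_n\succ Y$ be the left combs. Let $\phi:\mathsf{PL}\to\operatorname{Dend}$ be the unique linear map with $\phi(\bullet)=Y$ and $\phi(x\curvearrowleft y)=\phi(y)\succ\phi(x)-\phi(x)\prec\phi(y)$, extended degree by degree to the completions. **Noncommutative symmetric functions.** Let $\mathbf{Sym}$ be the free unital associative algebra on $S_1,S_2,\dots$, with $S_0=1$; let $\Psi_n$ ($n\ge1$) be determined by $nS_n=\sum_{i=0}^{n-1}S_i\Psi_{n-i}$. Let $S_n(\frac{A}{1-q})$ be determined by $S_0(\frac{A}{1-q})=1$ and $S_n(\frac{A}{1-q})=\sum_{i+j=n}q^iS_i(\frac{A}{1-q})S_j$, that is, their generating series is the infinite product $\cdots\sigma(q^2t)\sigma(qt)\sigma(t)$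 with $\sigma(t)=\sum_nS_nt^n$, and let $\Psi_n(\frac{A}{1-q})$ be the image of $\Psi_n$ under the algebra endomorphism $S_n\mapsto S_n(\frac{A}{1-q})$. Let $\theta$ be the morphism of unital algebras from $\mathbf{Sym}$ to $\operatorname{Dend}$ (with unit) such that $\theta(S_n)=L_n$ for all $n$. **Proposition.** The image under $\theta$ of $(1-q)\sum_{n\ge1}\Psi_n(\frac{A}{1-q})$ is the image under $\phi$ of the suspension of $\Omega_q$; that is, for all $n\ge1$, $$\theta\Big((1-q)\,\Psi_n\big(\tfrac{A}{1-q}\big)\Big)=(-1)^{n-1}\,\phi(\Omega_{q,n}).$$ -/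

import Mathlib

namespace QOmega

/-! ### Rooted trees -/

/-- Planar (ordered) rooted trees: `vertex` is the one-vertex tree, and `attach a b` is `a` with
one more (last) subtree `b` on its root, i.e. with a new edge from the root of `b` to the root of
`a`. -/
inductive PlanarTree : Type
  | vertex : PlanarTree
  | attach (a b : PlanarTree) : PlanarTree

namespace PlanarTree

/-- Exchange of two neighbouring subtrees of one vertex. -/
inductive Swap : PlanarTree → PlanarTree → Prop
  | swap (a b c : PlanarTree) : Swap ((a.attach b).attach c) ((a.attach c).attach b)
  | left {a a' : PlanarTree} (b : PlanarTree) : Swap a a' → Swap (a.attach b) (a'.attach b)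
  | right (a : PlanarTree) {b b' : PlanarTree} : Swap b b' → Swap (a.attach b) (a.attach b')

/-- The number of vertices. -/
def order : PlanarTree → ℕ
  | vertex => 1
  | attach a b => a.order + b.order

/-- The number of edges at the root. -/
def rootDegree : PlanarTree → ℕ
  | vertex => 0
  | attach a _ => a.rootDegree + 1

end PlanarTree

/-- (Unlabelled, non-planar) rooted trees: planar rooted trees up to reordering the subtrees
of the vertices. -/
def RTree : Type := Quot PlanarTree.Swap

namespace RTree

/-- The rooted tree underlying a planar rooted tree. -/
def mk (a : PlanarTree) : RTree := Quot.mk _ a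

theorem mk_eq {a b : PlanarTree} (h : a.Swap b) : mk a = mk b := Quot.sound h

/-- The tree with one vertex. -/
def vertex : RTree := mk .vertex

/-- Add an edge from the root of the second tree to the root of the first one. -/
def attach : RTree → RTree → RTree :=
  Quot.map₂ PlanarTree.attach (fun a _ _ h => .right a h) (fun _ _ b h => .left b h)

theorem attach_swap (a b c : RTree) : (a.attach b).attach c = (a.attach c).attach b := by
  induction a using Quot.ind
  induction b using Quot.ind
  induction c using Quot.ind
  exact Quot.sound (.swap _ _ _)

theorem ind {P : RTree → Prop} (h0 : P vertex)
    (h1 : ∀ a b, P a → P b → P (attach a b)) (T : RTree) : P T := by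
  induction T using Quot.ind with
  | mk a =>
    induction a with
    | vertex => exact h0
    | attach a b iha ihb => exact h1 _ _ iha ihb

/-- The number of vertices. -/
def order : RTree → ℕ :=
  Quot.lift PlanarTree.order (by
    intro a b h
    induction h with
    | swap a b c => simp only [PlanarTree.order]; omega
    | left b _ ih => simp only [PlanarTree.order, ih]
    | right a _ ih => simp only [PlanarTree.order, ih])

theorem order_vertex : vertex.order = 1 := rfl

theorem order_attach (a b : RTree) : (attach a b).order = a.order + b.order := by
  induction a using Quot.ind
  induction b using Quot.ind
  rfl

theorem order_pos (a : RTree) : 0 < a.order := by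
  induction a using ind with
  | h0 => simp [order_vertex]
  | h1 a b ha hb => rw [order_attach]; omega

/-- The number of edges at the root. -/
def rootDegree : RTree → ℕ :=
  Quot.lift PlanarTree.rootDegree (by
    intro a b h
    induction h with
    | swap a b c => simp only [PlanarTree.rootDegree]
    | left b _ ih => simp only [PlanarTree.rootDegree, ih]
    | right a _ ih => simp only [PlanarTree.rootDegree])

theorem rootDegree_attach (a b : RTree) : (attach a b).rootDegree = a.rootDegree + 1 := by
  induction a using Quot.ind
  induction b using Quot.ind
  rfl

end RTree

/-- Auxiliary form of `RTree.graft`. A vertex of `attach a b` is a vertex of `a` or a vertex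
of `b`. -/
def PlanarTree.graft : PlanarTree → RTree → Multiset RTree
  | .vertex, t => {RTree.vertex.attach t}
  | .attach a b, t =>
      (a.graft t).map (fun x => x.attach (RTree.mk b)) +
      (b.graft t).map (fun x => (RTree.mk a).attach x)

namespace RTree

/-- The multiset of all trees obtained from the disjoint union of `T` and `T'` by adding an edge
from the root of `T'` to one of the vertices of `T`. -/
def graft (T T' : RTree) : Multiset RTree :=
  Quot.lift (fun a => PlanarTree.graft a T') (by
    intro a b h
    induction h with
    | swap a b c =>
      have e (x y : PlanarTree) : mk (x.attach y) = (mk x).attach (mk y) := rfl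
      simp only [PlanarTree.graft, Multiset.map_add, Multiset.map_map, Function.comp_def, e]
      rw [add_assoc, add_assoc]
      congr 1
      · simp only [attach_swap _ (mk b) (mk c)]
      · rw [add_comm]
        simp only [attach_swap (mk a) _ (mk c), attach_swap (mk a) _ (mk b)]
    | left b h ih => simp only [PlanarTree.graft, ih, mk_eq h]
    | right a h ih => simp only [PlanarTree.graft, ih, mk_eq h]) T

theorem graft_vertex (t : RTree) : graft vertex t = {vertex.attach t} := rfl

theorem graft_attach (a b t : RTree) : graft (attach a b) t =
    (graft a t).map (fun x => x.attach b) + (graft b t).map (fun x => a.attach x) := by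
  induction a using Quot.ind
  induction b using Quot.ind
  rfl

theorem order_graft (a b : RTree) : ∀ x ∈ graft a b, x.order = a.order + b.order := by
  induction a using ind with
  | h0 => simp [graft_vertex, order_attach]
  | h1 a c iha ihc =>
    intro x hx
    rw [graft_attach, Multiset.mem_add, Multiset.mem_map, Multiset.mem_map] at hx
    rcases hx with ⟨y, hy, rfl⟩ | ⟨y, hy, rfl⟩
    · have := iha y hy
      simp only [order_attach]; omega
    · have := ihc y hy
      simp only [order_attach]; omega

theorem graft_eq_cons (a b : RTree) : ∃ M : Multiset RTree,
    graft a b = attach a b ::ₘ M ∧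
      ∀ x ∈ M, x.order = a.order + b.order ∧ x.rootDegree = a.rootDegree := by
  induction a using ind with
  | h0 => exact ⟨0, by simp [graft_vertex]⟩
  | h1 a c iha _ =>
    obtain ⟨M, hM, h⟩ := iha
    refine ⟨M.map (fun x => x.attach c) + (graft c b).map (fun x => a.attach x), ?_, ?_⟩
    · rw [graft_attach, hM, Multiset.map_cons, Multiset.cons_add, attach_swap]
    · intro x hx
      rw [Multiset.mem_add, Multiset.mem_map, Multiset.mem_map] at hx
      rcases hx with ⟨y, hy, rfl⟩ | ⟨y, hy, rfl⟩
      · have := h y hy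
        simp only [order_attach, rootDegree_attach]; omega
      · have := order_graft c b y hy
        simp only [order_attach, rootDegree_attach, and_true]; omega

end RTree

/-! ### The free pre-Lie algebra on one generator -/

theorem lin_ind {K ι : Type} [Field K] {P : (ι →₀ K) → Prop} (h0 : P 0)
    (hadd : ∀ x y, P x → P y → P (x + y)) (hsmul : ∀ (c : K) x, P x → P (c • x))
    (h1 : ∀ T, P (Finsupp.single T 1)) (x : ι →₀ K) : P x := by
  induction x using Finsupp.induction_linear with
  | zero => exact h0
  | add f g hf hg => exact hadd _ _ hf hg
  | single T c =>
    have := hsmul c _ (h1 T)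
    rwa [Finsupp.smul_single, smul_eq_mul, mul_one] at this

/-- The free pre-Lie algebra on one generator: the vector space with basis the rooted trees. -/
def PL (K : Type) [Field K] : Type := RTree →₀ K

namespace PL

variable {K : Type} [Field K]

noncomputable instance : AddCommGroup (PL K) := inferInstanceAs (AddCommGroup (RTree →₀ K))

noncomputable instance : Module K (PL K) := inferInstanceAs (Module K (RTree →₀ K))

/-- The basis element given by a rooted tree. -/
noncomputable def tree (T : RTree) : PL K := Finsupp.single T (1 : K)

/-- The linear map with given values on the basis. -/
noncomputable def lift {M : Type} [AddCommGroup M] [Module K M] (f : RTree → M) : PL K →ₗ[K] M :=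
  Finsupp.linearCombination K f

theorem lift_tree {M : Type} [AddCommGroup M] [Module K M] (f : RTree → M) (T : RTree) :
    lift (K := K) f (tree T) = f T := by
  refine (Finsupp.linearCombination_single K (1 : K) T).trans ?_
  rw [one_smul]

theorem ind {P : PL K → Prop} (h0 : P 0)
    (hadd : ∀ x y, P x → P y → P (x + y)) (hsmul : ∀ (c : K) x, P x → P (c • x))
    (h1 : ∀ T, P (tree T)) (x : PL K) : P x :=
  lin_ind (ι := RTree) h0 hadd hsmul h1 x

/-- The pre-Lie product `x ↶ y` on rooted trees. -/
noncomputable def graft : PL K →ₗ[K] PL K →ₗ[K] PL K :=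
  lift fun T => lift fun T' => ((RTree.graft T T').map tree).sum

/-- The rooted tree with one vertex. -/
noncomputable def vertex : PL K := tree RTree.vertex

theorem graft_tree (T T' : RTree) :
    graft (tree T : PL K) (tree T') = ((RTree.graft T T').map tree).sum := by
  rw [graft, lift_tree, lift_tree]

/-- The bilinear extension of `RTree.attach`. -/
noncomputable def attach : PL K →ₗ[K] PL K →ₗ[K] PL K :=
  lift fun T => lift fun T' => tree (RTree.attach T T')

theorem attach_tree (T T' : RTree) :
    attach (tree T : PL K) (tree T') = tree (RTree.attach T T') := by
  rw [attach, lift_tree, lift_tree]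

theorem attach_swap (x y z : PL K) : attach (attach x y) z = attach (attach x z) y := by
  induction x using PL.ind with
  | h0 => simp
  | hadd a b ha hb => simp [ha, hb]
  | hsmul c a ha => simp [ha]
  | h1 T =>
  induction y using PL.ind with
  | h0 => simp
  | hadd a b ha hb => simp [ha, hb]
  | hsmul c a ha => simp [ha]
  | h1 U =>
  induction z using PL.ind with
  | h0 => simp
  | hadd a b ha hb => simp [ha, hb]
  | hsmul c a ha => simp [ha]
  | h1 W => simp only [attach_tree, RTree.attach_swap T U W]

theorem graft_vertex (y : PL K) : graft vertex y = attach vertex y := by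
  induction y using PL.ind with
  | h0 => simp
  | hadd a b ha hb => simp [ha, hb]
  | hsmul c a ha => simp [ha]
  | h1 U => simp [vertex, graft_tree, attach_tree, RTree.graft_vertex]

theorem graft_attach (x y z : PL K) :
    graft (attach x y) z = attach (graft x z) y + attach x (graft y z) := by
  induction x using PL.ind with
  | h0 => simp
  | hadd a b ha hb => simp only [map_add, LinearMap.add_apply, ha, hb]; abel
  | hsmul c a ha => simp [ha]
  | h1 T =>
  induction y using PL.ind with
  | h0 => simp
  | hadd a b ha hb => simp only [map_add, LinearMap.add_apply, ha, hb]; abel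
  | hsmul c a ha => simp [ha]
  | h1 U =>
  induction z using PL.ind with
  | h0 => simp
  | hadd a b ha hb => simp only [map_add, LinearMap.add_apply, ha, hb]; abel
  | hsmul c a ha => simp [ha]
  | h1 W =>
    have h (f : PL K →ₗ[K] PL K) (s : Multiset (PL K)) : f s.sum = (s.map f).sum :=
      map_multiset_sum f s
    have h' (s : Multiset (PL K)) (v : PL K) :
        attach s.sum v = (s.map fun u => attach u v).sum := h (attach.flip v) s
    simp only [attach_tree, graft_tree, RTree.graft_attach, Multiset.map_add,
      Multiset.sum_add, Multiset.map_map, h, h', Function.comp_def]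

/-- The product is a right pre-Lie product. -/
theorem graft_preLie (x y z : PL K) :
    graft (graft x y) z - graft x (graft y z) = graft (graft x z) y - graft x (graft z y) := by
  induction x using PL.ind with
  | h0 => simp
  | hadd a b ha hb =>
    simp only [map_add, LinearMap.add_apply]
    rw [add_sub_add_comm, ha, hb]; abel
  | hsmul c a ha => simp only [map_smul, LinearMap.smul_apply, ← smul_sub, ha]
  | h1 T =>
  induction T using RTree.ind with
  | h0 =>
    change graft (graft vertex y) z - graft vertex (graft y z) =
      graft (graft vertex z) y - graft vertex (graft z y)
    simp only [graft_vertex, graft_attach]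
    rw [attach_swap vertex z y]; abel
  | h1 a b ha hb =>
    simp only [← attach_tree, graft_attach, map_add, LinearMap.add_apply]
    have ea := congrArg (fun u => attach u (tree b)) ha
    have eb := congrArg (fun u => attach (tree a) u) hb
    simp only [map_sub, LinearMap.sub_apply] at ea eb
    rw [sub_eq_iff_eq_add] at ea eb
    rw [ea, eb]; abel

end PL

/-! ### Universal property of the rooted trees -/

section Universal

variable {K V : Type} [Field K] [AddCommGroup V] [Module K V] (p : V →ₗ[K] V →ₗ[K] V)

/-- Sum of `f` over the lists obtained by replacing one entry `u` by `p u y`. -/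
def derivSum (y : V) : (List V → V) → List V → V
  | _, [] => 0
  | f, u :: l => f (p u y :: l) + derivSum y (fun l' => f (u :: l')) l

/-- Auxiliary form of `brace`; the number bounds the recursion depth. -/
def braceAux (v : V) : ℕ → List V → V
  | 0, _ => v
  | _ + 1, [] => v
  | n + 1, y :: l => p (braceAux v n l) y - derivSum p y (braceAux v n) l

/-- The symmetric braces `v{y₁, …, yₖ}` of a pre-Lie algebra. -/
def brace (v : V) (l : List V) : V := braceAux p v l.length l

theorem derivSum_congr (y : V) (l : List V) {f g : List V → V}
    (h : ∀ l', l'.length = l.length → f l' = g l') : derivSum p y f l = derivSum p y g l := by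
  induction l generalizing f g with
  | nil => rfl
  | cons u l ih =>
    simp only [derivSum]
    rw [h (p u y :: l) (by simp), ih]
    intro l' hl'
    exact h _ (by simp [hl'])

theorem brace_nil (v : V) : brace p v [] = v := rfl

theorem brace_cons (v y : V) (l : List V) :
    brace p v (y :: l) = p (brace p v l) y - derivSum p y (brace p v) l := by
  simp only [brace, List.length_cons, braceAux]
  congr 1
  exact derivSum_congr p y l fun l' h => by rw [brace, h]

theorem derivSum_add (y : V) (l : List V) (f g : List V → V) :
    derivSum p y (fun l' => f l' + g l') l = derivSum p y f l + derivSum p y g l := by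
  induction l generalizing f g with
  | nil => simp [derivSum]
  | cons u l ih => simp only [derivSum, ih]; abel

theorem derivSum_sub (y : V) (l : List V) (f g : List V → V) :
    derivSum p y (fun l' => f l' - g l') l = derivSum p y f l - derivSum p y g l := by
  induction l generalizing f g with
  | nil => simp [derivSum]
  | cons u l ih => simp only [derivSum, ih]; abel

theorem derivSum_map (y : V) (l : List V) (f : List V → V) (g : V →ₗ[K] V) :
    derivSum p y (fun l' => g (f l')) l = g (derivSum p y f l) := by
  induction l generalizing f with
  | nil => simp [derivSum]
  | cons u l ih => simp only [derivSum, ih, map_add]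

/-- Additivity in each entry, on lists of length `n`. -/
def AddOn (n : ℕ) (f : List V → V) : Prop :=
  ∀ (l₁ : List V) (x x' : V) (l₂ : List V), l₁.length + l₂.length + 1 = n →
    f (l₁ ++ (x + x') :: l₂) = f (l₁ ++ x :: l₂) + f (l₁ ++ x' :: l₂)

theorem AddOn.cons {n : ℕ} {f : List V → V} (h : AddOn (n + 1) f) (u : V) :
    AddOn n (fun l => f (u :: l)) := by
  intro l₁ x x' l₂ hl
  exact h (u :: l₁) x x' l₂ (by simp only [List.length_cons]; omega)

theorem AddOn.derivSum {n : ℕ} {f : List V → V} (h : AddOn n f) (y : V) :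
    AddOn n (derivSum p y f) := by
  intro l₁
  induction l₁ generalizing n f with
  | nil =>
    intro x x' l₂ hl
    have hf := fun a b => h [] a b l₂ hl
    simp only [List.nil_append] at hf
    simp only [List.nil_append, QOmega.derivSum, map_add, LinearMap.add_apply, hf]
    rw [derivSum_congr p y l₂ (g := fun l' => f (x :: l') + f (x' :: l')), derivSum_add]
    · abel
    · intro l' hl'
      exact h [] x x' l' (by simp_all)
  | cons u l₁ ih =>
    intro x x' l₂ hl
    have e1 := h (p u y :: l₁) x x' l₂ hl
    have e2 := ih (n := l₁.length + l₂.length + 1) (f := fun l => f (u :: l))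
      (AddOn.cons (by convert h using 1; simp only [List.length_cons] at hl; omega) u) x x' l₂ rfl
    simp only [List.cons_append] at e1
    simp only [List.cons_append, QOmega.derivSum, e1, e2]
    abel

theorem derivSum_add_left {f : List V → V} (y y' : V) (l : List V) (h : AddOn l.length f) :
    derivSum p (y + y') f l = derivSum p y f l + derivSum p y' f l := by
  induction l generalizing f with
  | nil => simp [derivSum]
  | cons u l ih =>
    have e := h [] (p u y) (p u y') l (by simp)
    simp only [List.nil_append] at e
    simp only [derivSum, map_add, e, ih (h.cons u)]
    abel

theorem brace_addOn (v : V) (n : ℕ) : AddOn n (brace p v) := by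
  induction n with
  | zero => intro l₁ x x' l₂ h; omega
  | succ n ih =>
    intro l₁ x x' l₂ h
    cases l₁ with
    | nil =>
      have : l₂.length = n := by simpa using h
      subst this
      simp only [List.nil_append, brace_cons, map_add, derivSum_add_left p x x' l₂ ih]
      abel
    | cons u l₁ =>
      have hl : l₁.length + l₂.length + 1 = n := by simp only [List.length_cons] at h; omega
      simp only [List.cons_append, brace_cons, ih l₁ x x' l₂ hl, (ih.derivSum p u) l₁ x x' l₂ hl,
        map_add, LinearMap.add_apply]
      abel

theorem derivSum_symm
    (hp : ∀ x y z, p (p x y) z - p x (p y z) = p (p x z) y - p x (p z y))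
    (s t : V) (l : List V) {f : List V → V} (h : AddOn l.length f) :
    derivSum p (p t s) f l + derivSum p s (derivSum p t f) l =
      derivSum p (p s t) f l + derivSum p t (derivSum p s f) l := by
  induction l generalizing f with
  | nil => simp [derivSum]
  | cons u l ih =>
    have e1 := h [] (p u (p t s)) (p (p u s) t) l (by simp)
    have e2 := h [] (p u (p s t)) (p (p u t) s) l (by simp)
    have e3 : p u (p t s) + p (p u s) t = p u (p s t) + p (p u t) s := by
      have := hp u s t
      rw [sub_eq_iff_eq_add] at this
      rw [this]; abel
    rw [e3, e2] at e1
    simp only [List.nil_append] at e1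
    have e4 := ih (h.cons u)
    simp only [derivSum, derivSum_add]
    calc _ = (f (p u (p t s) :: l) + f (p (p u s) t :: l)) +
          (derivSum p (p t s) (fun l' => f (u :: l')) l +
            derivSum p s (derivSum p t fun l' => f (u :: l')) l) +
          (derivSum p t (fun l' => f (p u s :: l')) l +
            derivSum p s (fun l' => f (p u t :: l')) l) := by abel
      _ = _ := by rw [← e1, e4]; abel

theorem brace_swap
    (hp : ∀ x y z, p (p x y) z - p x (p y z) = p (p x z) y - p x (p z y))
    (v s t : V) (l : List V) : brace p v (s :: t :: l) = brace p v (t :: s :: l) := by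
  have key : ∀ s t : V, brace p v (s :: t :: l) =
      (p (p (brace p v l) t) s - p (brace p v l) (p t s)) -
        (p (derivSum p t (brace p v) l) s + p (derivSum p s (brace p v) l) t) +
        (derivSum p (p t s) (brace p v) l + derivSum p s (derivSum p t (brace p v)) l) := by
    intro s t
    have e : derivSum p s (fun l' => brace p v (t :: l')) l =
        p (derivSum p s (brace p v) l) t - derivSum p s (derivSum p t (brace p v)) l := by
      simp only [brace_cons]
      rw [derivSum_sub]
      congr 1
      exact derivSum_map p s l (brace p v) (p.flip t)
    rw [brace_cons p v s (t :: l)]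
    simp only [derivSum]
    rw [e, brace_cons p v t l, brace_cons p v (p t s) l]
    simp only [map_sub, LinearMap.sub_apply]
    abel
  rw [key s t, key t s, hp, derivSum_symm p hp s t l (brace_addOn p v _)]
  abel

theorem derivSum_perm (y : V) {l l' : List V} (h : l.Perm l') {f : List V → V}
    (hf : ∀ a b : List V, a.length = l.length → a.Perm b → f a = f b) :
    derivSum p y f l = derivSum p y f l' := by
  induction h generalizing f with
  | nil => rfl
  | cons u h ih =>
    simp only [derivSum]
    rw [hf _ _ (by simp) (h.cons _), ih]
    intro a b ha hab
    exact hf _ _ (by simp [ha]) (hab.cons u)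
  | swap a b l =>
    simp only [derivSum]
    rw [hf (p b y :: a :: l) (a :: p b y :: l) (by simp) (.swap _ _ _),
      hf (b :: p a y :: l) (p a y :: b :: l) (by simp) (.swap _ _ _),
      derivSum_congr p y l (g := fun l' => f (a :: b :: l'))]
    · abel
    · intro l' hl'
      exact hf _ _ (by simp [hl']) (.swap _ _ _)
  | trans h1 h2 ih1 ih2 =>
    rw [ih1 hf, ih2]
    intro a b ha hab
    exact hf a b (by rw [ha, h1.length_eq]) hab

theorem brace_perm
    (hp : ∀ x y z, p (p x y) z - p x (p y z) = p (p x z) y - p x (p z y))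
    (v : V) {l l' : List V} (h : l.Perm l') : brace p v l = brace p v l' := by
  suffices H : ∀ n, ∀ a b : List V, a.length = n → a.Perm b → brace p v a = brace p v b from
    H _ l l' rfl h
  intro n
  induction n using Nat.strong_induction_on with
  | _ n ih =>
    intro a b ha hab
    induction hab with
    | nil => rfl
    | cons u h _ =>
      have hn := fun a' b' (h' : a'.length = _) => ih _ (by
        rw [← ha, List.length_cons]; exact Nat.lt_succ_self _) a' b' h'
      rw [brace_cons, brace_cons, hn _ _ rfl h, derivSum_perm p u h hn]
    | swap a b l => exact brace_swap p hp v b a l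
    | trans h1 h2 ih1 ih2 => rw [ih1 ha, ih2 (by rw [← h1.length_eq, ha])]

/-- The values on the subtrees at the root of a planar tree, for the morphism with
`vertex ↦ v`. -/
def branches (v : V) : PlanarTree → List V
  | .vertex => []
  | .attach a b => brace p v (branches v b) :: branches v a

theorem branches_perm
    (hp : ∀ x y z, p (p x y) z - p x (p y z) = p (p x z) y - p x (p z y))
    (v : V) {a b : PlanarTree} (h : a.Swap b) : (branches p v a).Perm (branches p v b) := by
  induction h with
  | swap a b c => exact .swap _ _ _
  | left b _ ih => exact ih.cons _
  | right a _ ih =>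
    simp only [branches]
    rw [brace_perm p hp v ih]

/-- The value on a rooted tree of the morphism with `vertex ↦ v`. -/
def treeValue (hp : ∀ x y z, p (p x y) z - p x (p y z) = p (p x z) y - p x (p z y))
    (v : V) : RTree → V :=
  Quot.lift (fun a => brace p v (branches p v a))
    fun _ _ h => brace_perm p hp v (branches_perm p hp v h)

/-- The values on the subtrees at the root of a rooted tree. -/
def treeBranches (hp : ∀ x y z, p (p x y) z - p x (p y z) = p (p x z) y - p x (p z y))
    (v : V) : RTree → Multiset V :=
  Quot.lift (fun a => (branches p v a : Multiset V))
    fun _ _ h => Multiset.coe_eq_coe.2 (branches_perm p hp v h)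

/-- The symmetric braces as a function on multisets. -/
def mbrace (hp : ∀ x y z, p (p x y) z - p x (p y z) = p (p x z) y - p x (p z y))
    (v : V) : Multiset V → V :=
  Quot.lift (brace p v) fun _ _ h => brace_perm p hp v h

theorem sum_mbrace_graft
    (hp : ∀ x y z, p (p x y) z - p x (p y z) = p (p x z) y - p x (p z y))
    (v : V) (t : RTree) (a : PlanarTree) (c : List V) :
    ((RTree.graft (RTree.mk a) t).map
        fun x => mbrace p hp v (treeBranches p hp v x + (c : Multiset V))).sum =
      brace p v (treeValue p hp v t :: (branches p v a ++ c)) +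
        derivSum p (treeValue p hp v t) (fun l => brace p v (l ++ c)) (branches p v a) := by
  have hm : ∀ l : List V, mbrace p hp v (l : Multiset V) = brace p v l := fun _ => rfl
  have hb : ∀ x : RTree, mbrace p hp v (treeBranches p hp v x) = treeValue p hp v x := by
    intro x; induction x using Quot.ind; rfl
  have ha : ∀ x y : RTree, treeBranches p hp v (x.attach y) =
      treeValue p hp v y ::ₘ treeBranches p hp v x := by
    intro x y; induction x using Quot.ind; induction y using Quot.ind; rfl
  have hbr : ∀ a : PlanarTree, treeBranches p hp v (RTree.mk a) = (branches p v a : Multiset V) :=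
    fun _ => rfl
  induction a generalizing c with
  | vertex =>
    change ((RTree.graft RTree.vertex t).map _).sum = _
    rw [RTree.graft_vertex, Multiset.map_singleton, Multiset.sum_singleton, ha]
    change brace p v (treeValue p hp v t :: ([] ++ c)) = _ + 0
    rw [add_zero]; rfl
  | attach a b iha ihb =>
    have e : RTree.mk (a.attach b) = (RTree.mk a).attach (RTree.mk b) := rfl
    set y := treeValue p hp v t with hy
    set w := brace p v (branches p v b) with hw
    have hwb : treeValue p hp v (RTree.mk b) = w := rfl
    rw [e, RTree.graft_attach, Multiset.map_add, Multiset.sum_add, Multiset.map_map,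
      Multiset.map_map]
    have h1 := iha (w :: c)
    have h2 := ihb []
    simp only [Multiset.coe_nil, add_zero, List.append_nil, hb] at h2
    rw [brace_cons, sub_add_cancel] at h2
    have h3 : ((RTree.graft (RTree.mk b) t).map
        fun x => brace p v (treeValue p hp v x :: (branches p v a ++ c))).sum =
        brace p v (p w y :: (branches p v a ++ c)) := by
      let F : V →+ V := AddMonoidHom.mk' (fun u => brace p v (u :: (branches p v a ++ c)))
        fun x x' => brace_addOn p v _ [] x x' _ rfl
      have := map_multiset_sum F ((RTree.graft (RTree.mk b) t).map (treeValue p hp v))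
      rw [h2, Multiset.map_map] at this
      exact this.symm
    have e1 : ((fun x => mbrace p hp v (treeBranches p hp v x + (c : Multiset V))) ∘
        fun x : RTree => x.attach (RTree.mk b)) =
        fun x => mbrace p hp v (treeBranches p hp v x + ((w :: c : List V) : Multiset V)) := by
      funext x
      simp only [Function.comp, ha, hwb]
      rw [← Multiset.cons_coe, Multiset.cons_add, Multiset.add_cons]
    have e2 : ((fun x => mbrace p hp v (treeBranches p hp v x + (c : Multiset V))) ∘
        fun x : RTree => (RTree.mk a).attach x) =
        fun x => brace p v (treeValue p hp v x :: (branches p v a ++ c)) := by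
      funext x
      simp only [Function.comp, ha, hbr, Multiset.coe_add, Multiset.cons_coe, hm,
        List.cons_append]
    rw [e1, e2, h1, h3]
    have e3 : branches p v (a.attach b) = w :: branches p v a := rfl
    rw [e3]
    simp only [derivSum]
    rw [brace_perm p hp v (l := y :: (branches p v a ++ w :: c))
      (l' := y :: (w :: branches p v a ++ c)) (List.perm_middle.cons y),
      derivSum_congr p y (branches p v a) (g := fun l' => brace p v (w :: l' ++ c))
        fun l' _ => brace_perm p hp v List.perm_middle]
    simp only [List.cons_append]
    abel

theorem PL.hom_ext {φ ψ : PL K →ₗ[K] V} (h0 : φ PL.vertex = ψ PL.vertex)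
    (hφ : ∀ x y, φ (PL.graft x y) = p (φ x) (φ y))
    (hψ : ∀ x y, ψ (PL.graft x y) = p (ψ x) (ψ y)) : φ = ψ := by
  suffices H : ∀ n d (T : RTree), T.order = n → T.rootDegree = d →
      φ (PL.tree T) = ψ (PL.tree T) by
    refine LinearMap.ext fun x => ?_
    induction x using PL.ind with
    | h0 => simp
    | hadd a b ha hb => simp only [map_add, ha, hb]
    | hsmul c a ha => simp only [map_smul, ha]
    | h1 T => exact H _ _ T rfl rfl
  intro n
  induction n using Nat.strong_induction_on with
  | _ n ihn =>
  intro d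
  induction d using Nat.strong_induction_on with
  | _ d ihd =>
  intro T hn hd
  induction T using RTree.ind with
  | h0 => exact h0
  | h1 a b _ _ =>
    rw [RTree.order_attach] at hn
    rw [RTree.rootDegree_attach] at hd
    have pa := a.order_pos
    have pb := b.order_pos
    have ea := ihn a.order (by omega) _ a rfl rfl
    have eb := ihn b.order (by omega) _ b rfl rfl
    obtain ⟨M, hM, h⟩ := RTree.graft_eq_cons a b
    have e := PL.graft_tree (K := K) a b
    rw [hM, Multiset.map_cons, Multiset.sum_cons] at e
    have e1 := hφ (PL.tree a) (PL.tree b)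
    have e2 := hψ (PL.tree a) (PL.tree b)
    rw [e, map_add, map_multiset_sum, Multiset.map_map] at e1 e2
    rw [ea, eb, ← e2] at e1
    have e3 : M.map (φ ∘ PL.tree) =
        M.map (ψ ∘ PL.tree) :=
      Multiset.map_congr rfl fun x hx =>
        ihd a.rootDegree (by omega) x (by rw [(h x hx).1, hn]) (h x hx).2
    rw [e3] at e1
    exact add_right_cancel e1

/-- The rooted trees with the grafting product form the free pre-Lie algebra on the tree with
one vertex. -/
theorem PL.existsUnique_hom
    (hp : ∀ x y z, p (p x y) z - p x (p y z) = p (p x z) y - p x (p z y)) (v : V) :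
    ∃! φ : PL K →ₗ[K] V, φ PL.vertex = v ∧ ∀ x y, φ (PL.graft x y) = p (φ x) (φ y) := by
  refine existsUnique_of_exists_of_unique
    ⟨PL.lift (treeValue p hp v), ?_, ?_⟩
    fun φ ψ h h' => PL.hom_ext p (h.1.trans h'.1.symm) h.2 h'.2
  · simp only [PL.vertex, PL.lift_tree]
    rfl
  · intro x y
    induction x using PL.ind with
    | h0 => simp
    | hadd a b ha hb => simp only [map_add, LinearMap.add_apply, ha, hb]
    | hsmul c a ha => simp only [map_smul, LinearMap.smul_apply, ha]
    | h1 T =>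
    induction y using PL.ind with
    | h0 => simp
    | hadd a b ha hb => simp only [map_add, ha, hb]
    | hsmul c a ha => simp only [map_smul, ha]
    | h1 U =>
      have hb : ∀ x : RTree, mbrace p hp v (treeBranches p hp v x) = treeValue p hp v x := by
        intro x; induction x using Quot.ind; rfl
      induction T using Quot.ind with
      | mk a =>
      have := sum_mbrace_graft p hp v U a []
      simp only [Multiset.coe_nil, add_zero, List.append_nil, hb] at this
      rw [brace_cons, sub_add_cancel] at this
      change PL.lift (treeValue p hp v)
        (PL.graft (PL.tree (RTree.mk a)) _) =
        p (PL.lift (treeValue p hp v) (PL.tree (RTree.mk a))) _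
      rw [PL.graft_tree, map_multiset_sum, Multiset.map_map]
      simp only [Function.comp_def, PL.lift_tree]
      exact this

end Universal

/-! ### The free dendriform algebra on one generator -/

/-- Planar binary trees, including the tree `nil` without inner vertex. -/
abbrev BTree : Type := BinaryTree Unit

/-- Planar binary trees with at least one inner vertex: `(l, r)` is the tree whose root has the
left subtree `l` and the right subtree `r`. -/
abbrev PBTree : Type := BTree × BTree

section Star

variable (K : Type) [Field K]

/-- The associative product of planar binary trees, with unit `nil`:
`(l ∨ r) * (l' ∨ r') = l ∨ (r * (l' ∨ r')) + ((l ∨ r) * l') ∨ r'`. -/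
noncomputable def star : BTree → BTree → (BTree →₀ K)
  | .nil, s => Finsupp.single s 1
  | .node _ l r, .nil => Finsupp.single (.node () l r) 1
  | .node _ l r, .node _ l' r' =>
      Finsupp.mapDomain (fun u => .node () l u) (star r (.node () l' r')) +
      Finsupp.mapDomain (fun u => .node () u r') (star (.node () l r) l')
termination_by t s => t.numNodes + s.numNodes
decreasing_by all_goals simp only [BinaryTree.numNodes]; omega

/-- The bilinear extension of `star`. -/
noncomputable def starL : (BTree →₀ K) →ₗ[K] (BTree →₀ K) →ₗ[K] (BTree →₀ K) :=
  Finsupp.linearCombination K fun t => Finsupp.linearCombination K fun s => star K t s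

/-- The bilinear extension of `(l, r) ↦ l ∨ r`. -/
noncomputable def nodeL : (BTree →₀ K) →ₗ[K] (BTree →₀ K) →ₗ[K] (BTree →₀ K) :=
  Finsupp.linearCombination K fun l => Finsupp.linearCombination K fun r =>
    Finsupp.single (.node () l r) 1

variable {K}

theorem starL_single (t s : BTree) :
    starL K (Finsupp.single t 1) (Finsupp.single s 1) = star K t s := by
  simp [starL]

theorem nodeL_single (l r : BTree) :
    nodeL K (Finsupp.single l 1) (Finsupp.single r 1) = Finsupp.single (.node () l r) 1 := by
  simp [nodeL]

theorem nil_starL (x : BTree →₀ K) : starL K (Finsupp.single .nil 1) x = x := by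
  induction x using lin_ind with
  | h0 => simp
  | hadd a b ha hb => simp only [map_add, ha, hb]
  | hsmul c a ha => simp only [map_smul, ha]
  | h1 T => rw [starL_single, star]

theorem starL_nil (x : BTree →₀ K) : starL K x (Finsupp.single .nil 1) = x := by
  induction x using lin_ind with
  | h0 => simp
  | hadd a b ha hb => simp only [map_add, LinearMap.add_apply, ha, hb]
  | hsmul c a ha => simp only [map_smul, LinearMap.smul_apply, ha]
  | h1 T => cases T <;> rw [starL_single, star]

theorem nodeL_left (l : BTree) (x : BTree →₀ K) :
    nodeL K (Finsupp.single l 1) x = Finsupp.mapDomain (fun u => .node () l u) x := by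
  induction x using lin_ind with
  | h0 => simp
  | hadd a b ha hb => simp only [map_add, ha, hb, Finsupp.mapDomain_add]
  | hsmul c a ha => simp only [map_smul, ha, Finsupp.mapDomain_smul]
  | h1 T => rw [nodeL_single, Finsupp.mapDomain_single]

theorem nodeL_right (r : BTree) (x : BTree →₀ K) :
    nodeL K x (Finsupp.single r 1) = Finsupp.mapDomain (fun u => .node () u r) x := by
  induction x using lin_ind with
  | h0 => simp
  | hadd a b ha hb => simp only [map_add, LinearMap.add_apply, ha, hb, Finsupp.mapDomain_add]
  | hsmul c a ha => simp only [map_smul, LinearMap.smul_apply, ha, Finsupp.mapDomain_smul]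
  | h1 T => rw [nodeL_single, Finsupp.mapDomain_single]

theorem starL_nodeL (x y x' y' : BTree →₀ K) :
    starL K (nodeL K x y) (nodeL K x' y') =
      nodeL K x (starL K y (nodeL K x' y')) + nodeL K (starL K (nodeL K x y) x') y' := by
  induction x using lin_ind with
  | h0 => simp
  | hadd a b ha hb => simp only [map_add, LinearMap.add_apply, ha, hb]; abel
  | hsmul c a ha => simp only [map_smul, LinearMap.smul_apply, ha, smul_add]
  | h1 l =>
  induction y using lin_ind with
  | h0 => simp
  | hadd a b ha hb => simp only [map_add, LinearMap.add_apply, ha, hb]; abel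
  | hsmul c a ha => simp only [map_smul, LinearMap.smul_apply, ha, smul_add]
  | h1 r =>
  induction x' using lin_ind with
  | h0 => simp
  | hadd a b ha hb => simp only [map_add, LinearMap.add_apply, ha, hb]; abel
  | hsmul c a ha => simp only [map_smul, LinearMap.smul_apply, ha, smul_add]
  | h1 l' =>
  induction y' using lin_ind with
  | h0 => simp
  | hadd a b ha hb => simp only [map_add, ha, hb]; abel
  | hsmul c a ha => simp only [map_smul, ha, smul_add]
  | h1 r' =>
    rw [nodeL_single, nodeL_single, starL_single, star, starL_single, starL_single, nodeL_left,
      nodeL_right]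

theorem starL_assoc (x y z : BTree →₀ K) :
    starL K (starL K x y) z = starL K x (starL K y z) := by
  induction x using lin_ind with
  | h0 => simp
  | hadd a b ha hb => simp only [map_add, LinearMap.add_apply, ha, hb]
  | hsmul c a ha => simp only [map_smul, LinearMap.smul_apply, ha]
  | h1 a =>
  induction y using lin_ind with
  | h0 => simp
  | hadd a b ha hb => simp only [map_add, LinearMap.add_apply, ha, hb]
  | hsmul c a ha => simp only [map_smul, LinearMap.smul_apply, ha]
  | h1 b =>
  induction z using lin_ind with
  | h0 => simp
  | hadd a b ha hb => simp only [map_add, ha, hb]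
  | hsmul c a ha => simp only [map_smul, ha]
  | h1 c =>
  induction a generalizing c with
  | nil => rw [nil_starL, nil_starL]
  | node _ l r _ ihr =>
  cases b with
  | nil => rw [nil_starL, starL_nil]
  | node _ l' r' =>
  induction c with
  | nil => rw [starL_nil, starL_nil]
  | node _ l'' r'' ihl =>
    have h1 := ihr (.node () l'' r'')
    have e (v : Unit) (l r : BTree) : (Finsupp.single (.node v l r) 1 : BTree →₀ K) =
      nodeL K (Finsupp.single l 1) (Finsupp.single r 1) := (nodeL_single l r).symm
    simp only [e] at h1 ihl ⊢
    clear ihr e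
    generalize Finsupp.single l (1 : K) = l at *
    generalize Finsupp.single r (1 : K) = r at *
    generalize Finsupp.single l' (1 : K) = l' at *
    generalize Finsupp.single r' (1 : K) = r' at *
    generalize Finsupp.single l'' (1 : K) = l'' at *
    generalize Finsupp.single r'' (1 : K) = r'' at *
    have e1 := starL_nodeL l r l' r'
    have e2 := starL_nodeL l' r' l'' r''
    calc _ = nodeL K l (starL K (starL K r (nodeL K l' r')) (nodeL K l'' r'')) +
          nodeL K (starL K (nodeL K l r) l') (starL K r' (nodeL K l'' r'')) +
          nodeL K (starL K (starL K (nodeL K l r) (nodeL K l' r')) l'') r'' := by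
            rw [e1]
            simp only [map_add, LinearMap.add_apply]
            rw [starL_nodeL, starL_nodeL]
            abel
      _ = _ := by
            rw [h1, ihl, e2]
            simp only [map_add]
            rw [starL_nodeL, starL_nodeL]
            abel

end Star

/-- The free dendriform algebra on one generator: the vector space with basis the planar binary
trees with at least one inner vertex. -/
def Dend (K : Type) [Field K] : Type := PBTree →₀ K

namespace Dend

variable {K : Type} [Field K]

noncomputable instance : AddCommGroup (Dend K) := inferInstanceAs (AddCommGroup (PBTree →₀ K))

noncomputable instance : Module K (Dend K) := inferInstanceAs (Module K (PBTree →₀ K))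

/-- The basis element `l ∨ r`. -/
noncomputable def tree (l r : BTree) : Dend K := Finsupp.single ((l, r) : PBTree) (1 : K)

/-- The linear map with given values on the basis. -/
noncomputable def lift {M : Type} [AddCommGroup M] [Module K M] (f : BTree → BTree → M) :
    Dend K →ₗ[K] M :=
  Finsupp.linearCombination K (fun t : PBTree => f t.1 t.2)

theorem lift_tree {M : Type} [AddCommGroup M] [Module K M] (f : BTree → BTree → M)
    (l r : BTree) : lift (K := K) f (tree l r) = f l r := by
  refine (Finsupp.linearCombination_single K (1 : K) ((l, r) : PBTree)).trans ?_
  rw [one_smul]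

theorem ind {P : Dend K → Prop} (h0 : P 0)
    (hadd : ∀ x y, P x → P y → P (x + y)) (hsmul : ∀ (c : K) x, P x → P (c • x))
    (h1 : ∀ l r, P (tree l r)) (x : Dend K) : P x :=
  lin_ind (ι := PBTree) h0 hadd hsmul (fun T => h1 T.1 T.2) x

/-- The bilinear extension of `(l, r) ↦ l ∨ r`. -/
noncomputable def join : (BTree →₀ K) →ₗ[K] (BTree →₀ K) →ₗ[K] Dend K :=
  Finsupp.linearCombination K fun l => Finsupp.linearCombination K fun r => tree l r

/-- The inclusion into the vector space on all planar binary trees. -/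
noncomputable def incl : Dend K →ₗ[K] (BTree →₀ K) :=
  lift fun l r => Finsupp.single (.node () l r) 1

/-- The product `≺`, with `(l ∨ r) ≺ s = l ∨ (r * s)`. -/
noncomputable def prec : Dend K →ₗ[K] Dend K →ₗ[K] Dend K :=
  lift fun l r => join (Finsupp.single l 1) ∘ₗ starL K (Finsupp.single r 1) ∘ₗ incl

/-- The product `≻`, with `s ≻ (l ∨ r) = (s * l) ∨ r`. -/
noncomputable def succ : Dend K →ₗ[K] Dend K →ₗ[K] Dend K :=
  LinearMap.flip <| lift fun l r =>
    join.flip (Finsupp.single r 1) ∘ₗ (starL K).flip (Finsupp.single l 1) ∘ₗ incl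

theorem join_single (l r : BTree) :
    join (Finsupp.single l (1 : K)) (Finsupp.single r 1) = tree l r := by
  simp [join]

theorem join_ind {P : Dend K → Prop} (h0 : P 0)
    (hadd : ∀ x y, P x → P y → P (x + y)) (hsmul : ∀ (c : K) x, P x → P (c • x))
    (h1 : ∀ l r, P (join l r)) (x : Dend K) : P x :=
  ind h0 hadd hsmul (fun l r => by rw [← join_single]; exact h1 _ _) x

theorem incl_join (x y : BTree →₀ K) : incl (join x y) = nodeL K x y := by
  induction x using lin_ind with
  | h0 => simp
  | hadd a b ha hb => simp only [map_add, LinearMap.add_apply, ha, hb]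
  | hsmul c a ha => simp only [map_smul, LinearMap.smul_apply, ha]
  | h1 l =>
  induction y using lin_ind with
  | h0 => simp
  | hadd a b ha hb => simp only [map_add, ha, hb]
  | hsmul c a ha => simp only [map_smul, ha]
  | h1 r => rw [join_single, incl, lift_tree, nodeL_single]

theorem prec_join (x y : BTree →₀ K) (z : Dend K) :
    prec (join x y) z = join x (starL K y (incl z)) := by
  induction x using lin_ind with
  | h0 => simp
  | hadd a b ha hb => simp only [map_add, LinearMap.add_apply, ha, hb]
  | hsmul c a ha => simp only [map_smul, LinearMap.smul_apply, ha]
  | h1 l =>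
  induction y using lin_ind with
  | h0 => simp
  | hadd a b ha hb => simp only [map_add, LinearMap.add_apply, ha, hb]
  | hsmul c a ha => simp only [map_smul, LinearMap.smul_apply, ha]
  | h1 r => rw [join_single, prec, lift_tree]; rfl

theorem succ_join (z : Dend K) (x y : BTree →₀ K) :
    succ z (join x y) = join (starL K (incl z) x) y := by
  induction x using lin_ind with
  | h0 => simp
  | hadd a b ha hb => simp only [map_add, LinearMap.add_apply, ha, hb]
  | hsmul c a ha => simp only [map_smul, LinearMap.smul_apply, ha]
  | h1 l =>
  induction y using lin_ind with
  | h0 => simp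
  | hadd a b ha hb => simp only [map_add, ha, hb]
  | hsmul c a ha => simp only [map_smul, ha]
  | h1 r => rw [join_single, succ, LinearMap.flip_apply, lift_tree]; rfl

theorem incl_prec_add_succ (x y : Dend K) :
    incl (prec x y + succ x y) = starL K (incl x) (incl y) := by
  induction x using join_ind with
  | h0 => simp
  | hadd a b ha hb =>
    simp only [map_add, LinearMap.add_apply] at ha hb ⊢
    rw [← ha, ← hb]; abel
  | hsmul c a ha => simp only [map_smul, LinearMap.smul_apply, ← smul_add, ha]
  | h1 l r =>
  induction y using join_ind with
  | h0 => simp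
  | hadd a b ha hb =>
    simp only [map_add] at ha hb ⊢
    rw [← ha, ← hb]; abel
  | hsmul c a ha => simp only [map_smul, ← smul_add, ha]
  | h1 l' r' => rw [prec_join, succ_join, map_add]; simp only [incl_join, starL_nodeL]

/-! The three axioms of dendriform algebras. -/

theorem prec_prec (x y z : Dend K) :
    prec x (prec y z) + prec x (succ y z) = prec (prec x y) z := by
  rw [← map_add]
  induction x using join_ind with
  | h0 => simp
  | hadd a b ha hb => simp only [map_add, LinearMap.add_apply] at ha hb ⊢; rw [← ha, ← hb]; abel
  | hsmul c a ha => simp only [map_smul, LinearMap.smul_apply, ha]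
  | h1 l r => rw [prec_join, prec_join, prec_join, incl_prec_add_succ, starL_assoc]

theorem succ_prec (x y z : Dend K) : succ x (prec y z) = prec (succ x y) z := by
  induction y using join_ind with
  | h0 => simp
  | hadd a b ha hb => simp only [map_add, LinearMap.add_apply, ha, hb]
  | hsmul c a ha => simp only [map_smul, LinearMap.smul_apply, ha]
  | h1 l r => rw [prec_join, succ_join, succ_join, prec_join]

theorem succ_succ (x y z : Dend K) :
    succ x (succ y z) = succ (succ x y) z + succ (prec x y) z := by
  rw [← LinearMap.add_apply, ← map_add, add_comm]
  induction z using join_ind with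
  | h0 => simp
  | hadd a b ha hb => simp only [map_add] at ha hb ⊢; rw [ha, hb]
  | hsmul c a ha => simp only [map_smul, ha]
  | h1 l r => rw [succ_join, succ_join, succ_join, incl_prec_add_succ, starL_assoc]

/-- The associative product `x * y = x ≻ y + x ≺ y`. -/
noncomputable instance : Mul (Dend K) := ⟨fun x y => succ x y + prec x y⟩

theorem mul_def (x y : Dend K) : x * y = succ x y + prec x y := rfl

noncomputable instance : NonUnitalRing (Dend K) where
  left_distrib x y z := by simp only [mul_def, map_add]; abel
  right_distrib x y z := by simp only [mul_def, map_add, LinearMap.add_apply]; abel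
  zero_mul x := by simp [mul_def]
  mul_zero x := by simp [mul_def]
  mul_assoc x y z := by
    simp only [mul_def, map_add, LinearMap.add_apply]
    rw [succ_succ, ← prec_prec, succ_prec]
    abel

instance : IsScalarTower K (Dend K) (Dend K) where
  smul_assoc c x y := by
    simp only [smul_eq_mul, mul_def, map_smul, LinearMap.smul_apply, smul_add]

instance : SMulCommClass K (Dend K) (Dend K) where
  smul_comm c x y := by
    simp only [smul_eq_mul, mul_def, map_smul, smul_add]

/-- The pre-Lie product `x ↶ y = y ≻ x - x ≺ y`. -/
noncomputable def preLie : Dend K →ₗ[K] Dend K →ₗ[K] Dend K := succ.flip - prec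

theorem preLie_apply (x y : Dend K) : preLie x y = succ y x - prec x y := rfl

theorem preLie_axiom (x y z : Dend K) :
    preLie (preLie x y) z - preLie x (preLie y z) =
      preLie (preLie x z) y - preLie x (preLie z y) := by
  simp only [preLie_apply, map_sub, LinearMap.sub_apply]
  rw [succ_succ z y x, succ_succ y z x, ← prec_prec x y z, ← prec_prec x z y, succ_prec, succ_prec]
  abel

/-- The planar binary tree with one inner vertex. -/
noncomputable def Y : Dend K := tree .nil .nil

end Dend

/-- The unique morphism of pre-Lie algebras from rooted trees to `Dend` that maps the rooted tree
with one vertex to the planar binary tree with one inner vertex. -/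
noncomputable def phi (K : Type) [Field K] : PL K →ₗ[K] Dend K :=
  (PL.existsUnique_hom (K := K) Dend.preLie Dend.preLie_axiom Dend.Y).choose

/-! ### The completed free pre-Lie algebra and the series `Ω` and `Ω_q` -/

section Completion

variable {K : Type} [Field K]

/-- The homogeneous component of degree `n`, spanned by the rooted trees with `n` vertices. -/
noncomputable def PL.deg (K : Type) [Field K] (n : ℕ) : Submodule K (PL K) :=
  Submodule.span K (PL.tree '' {T : RTree | T.order = n})

/-- The completion: the product of the homogeneous components. (The one of degree `0` is zero.) -/
abbrev PLhat (K : Type) [Field K] : Type := ∀ n : ℕ, PL.deg K n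

theorem PL.tree_mem_deg (T : RTree) : (PL.tree T : PL K) ∈ PL.deg K T.order :=
  Submodule.subset_span ⟨T, rfl, rfl⟩

theorem PL.vertex_mem_deg : (PL.vertex : PL K) ∈ PL.deg K 1 := by
  rw [← RTree.order_vertex]
  exact PL.tree_mem_deg _

theorem PL.graft_mem_deg {m n : ℕ} {x y : PL K} (hx : x ∈ PL.deg K m) (hy : y ∈ PL.deg K n) :
    PL.graft x y ∈ PL.deg K (m + n) := by
  unfold PL.deg at hx hy
  induction hx, hy using Submodule.span_induction₂ with
  | mem_mem x y hx hy =>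
    obtain ⟨T, rfl, rfl⟩ := hx
    obtain ⟨U, rfl, rfl⟩ := hy
    rw [PL.graft_tree]
    refine multiset_sum_mem _ fun a ha => ?_
    obtain ⟨W, hW, rfl⟩ := Multiset.mem_map.1 ha
    rw [← RTree.order_graft T U W hW]
    exact PL.tree_mem_deg W
  | zero_left y hy => simp
  | zero_right x hx => simp
  | add_left x y z _ _ _ h1 h2 =>
    rw [map_add, LinearMap.add_apply]; exact Submodule.add_mem _ h1 h2
  | add_right x y z _ _ _ h1 h2 => rw [map_add]; exact Submodule.add_mem _ h1 h2
  | smul_left r x y _ _ h =>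
    rw [map_smul, LinearMap.smul_apply]; exact Submodule.smul_mem _ _ h
  | smul_right r x y _ _ h => rw [map_smul]; exact Submodule.smul_mem _ _ h

theorem PLhat.zero_eq (x : PL.deg K 0) : x = 0 := by
  have h : {T : RTree | T.order = 0} = ∅ :=
    Set.eq_empty_of_forall_notMem fun T hT => T.order_pos.ne' hT
  obtain ⟨x, hx⟩ := x
  rw [PL.deg, h, Set.image_empty, Submodule.span_empty] at hx
  exact Subtype.ext ((Submodule.mem_bot K).1 hx)

namespace PLhat

/-- The series consisting of the tree with one vertex. -/
noncomputable def vertex : PLhat K := Pi.single 1 ⟨PL.vertex, PL.vertex_mem_deg⟩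

/-- The pre-Lie product `A ↶ B` of series. -/
noncomputable def graft (A B : PLhat K) : PLhat K := fun n =>
  ⟨∑ p ∈ Finset.HasAntidiagonal.antidiagonal n, PL.graft (A p.1 : PL K) (B p.2 : PL K),
    Submodule.sum_mem _ fun p hp => by
      have := PL.graft_mem_deg (A p.1).2 (B p.2).2
      rwa [Finset.HasAntidiagonal.mem_antidiagonal.1 hp] at this⟩

/-- The right action `x ↶ f(A)` of the element `f(A) = ∑ₖ fₖ A^k` of the completed enveloping
algebra, that is `∑ₖ fₖ ((x ↶ A) ↶ ⋯ ↶ A)` with `k` factors `A`. The `k`-th summand starts in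
degree at least `k`, so that the sum is finite in each degree. -/
noncomputable def act (f : PowerSeries K) (A x : PLhat K) : PLhat K := fun n =>
  ∑ k ∈ Finset.range (n + 1), f.coeff k • ((fun z => graft z A)^[k] x) n

/-- The `q`-shift `A[q] = ∑ₙ qⁿ Aₙ`. -/
noncomputable def shift (q : K) (A : PLhat K) : PLhat K := fun n => q ^ n • A n

/-- The suspension `∑ₙ (-1)ⁿ⁻¹ Aₙ`. -/
noncomputable def suspension (A : PLhat K) : PLhat K := fun n => (-1 : K) ^ (n + 1) • A n

theorem graft_congr {A A' B B' : PLhat K} {n : ℕ} (hA : ∀ m < n, A m = A' m)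
    (hB : ∀ m < n, B m = B' m) : graft A B n = graft A' B' n := by
  refine Subtype.ext ?_
  simp only [graft]
  refine Finset.sum_congr rfl fun p hp => ?_
  have hp := Finset.HasAntidiagonal.mem_antidiagonal.1 hp
  rcases Nat.eq_zero_or_pos p.1 with h | h
  · have e (C : PLhat K) : ((C p.1 : PL.deg K p.1) : PL K) = 0 := by
      rw [h, zero_eq (C 0)]; rfl
    rw [e A, e A']; simp
  rcases Nat.eq_zero_or_pos p.2 with h' | h'
  · have e (C : PLhat K) : ((C p.2 : PL.deg K p.2) : PL K) = 0 := by
      rw [h', zero_eq (C 0)]; rfl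
    rw [e B, e B']; simp
  rw [hA p.1 (by omega), hB p.2 (by omega)]

theorem iterate_congr {A B x y : PLhat K} {n : ℕ} (hA : ∀ m < n, A m = B m)
    (hx : ∀ m < n, x m = y m) (k : ℕ) :
    ∀ m < n, ((fun z => graft z A)^[k] x) m = ((fun z => graft z B)^[k] y) m := by
  induction k with
  | zero => exact hx
  | succ k ih =>
    intro m hm
    rw [Function.iterate_succ_apply', Function.iterate_succ_apply']
    exact graft_congr (fun i hi => ih i (hi.trans hm)) (fun i hi => hA i (hi.trans hm))

theorem iterate_congr' {A B x y : PLhat K} {n : ℕ} (hA : ∀ m < n, A m = B m)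
    (hx : ∀ m < n, x m = y m) {k : ℕ} (hk : k ≠ 0) :
    ((fun z => graft z A)^[k] x) n = ((fun z => graft z B)^[k] y) n := by
  obtain ⟨k, rfl⟩ := Nat.exists_eq_succ_of_ne_zero hk
  rw [Function.iterate_succ_apply', Function.iterate_succ_apply']
  exact graft_congr (iterate_congr hA hx k) hA

end PLhat

/-- A recursion that determines each component from the previous ones has a unique solution. -/
theorem existsUnique_fixed {M : ℕ → Type} [∀ n, Inhabited (M n)]
    (F : (∀ n, M n) → ∀ n, M n)
    (hF : ∀ n (A B : ∀ n, M n), (∀ m < n, A m = B m) → F A n = F B n) : ∃! A, F A = A := by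
  let G : ∀ n, (∀ m, m < n → M m) → M n :=
    fun n f => F (fun m => if h : m < n then f m h else default) n
  let A : ∀ n, M n := fun n => Nat.strongRecOn n G
  have hA : ∀ n, A n = F A n := by
    intro n
    have : A n = G n fun m _ => A m := Nat.strongRecOn_eq _ _
    rw [this]
    refine hF n _ _ fun m hm => ?_
    simp [hm]
  refine ⟨A, funext fun n => (hA n).symm, fun B hB => funext fun n => ?_⟩
  induction n using Nat.strong_induction_on with
  | _ n ih => rw [← hB, hA n]; exact hF n _ _ ih

variable (K) in
/-- There is a unique series `Ω` with `∙ ↶ (Ω / (exp Ω - 1)) = Ω`. -/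
theorem existsUnique_Omega [Algebra ℚ K] :
    ∃! A : PLhat K, PLhat.act (bernoulliPowerSeries K) A PLhat.vertex = A := by
  refine existsUnique_fixed _ fun n A B h => Finset.sum_congr rfl fun k _ => ?_
  congr 1
  rcases eq_or_ne k 0 with rfl | hk
  · rfl
  · exact PLhat.iterate_congr' h (fun _ _ => rfl) hk

variable (K) in
/-- The series `Ω`. -/
noncomputable def Omega [Algebra ℚ K] : PLhat K := (existsUnique_Omega K).choose

/-- There is a unique series `Ω_q` with
`Ω_q[q] ↶ (exp Ω - 1) + Ω_q[q] - Ω_q = ∙ ↶ Ω_q + (q - 1) ∙`. -/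
theorem existsUnique_OmegaQ [Algebra ℚ K] {q : K} (hq : ∀ n : ℕ, 0 < n → q ^ n ≠ 1) :
    ∃! A : PLhat K,
      PLhat.act (PowerSeries.exp K - 1) (Omega K) (PLhat.shift q A) + PLhat.shift q A - A =
        PLhat.graft PLhat.vertex A + (q - 1) • PLhat.vertex := by
  have H := existsUnique_fixed (M := fun n => PL.deg K n) (fun (A : PLhat K) n =>
    (q ^ n - 1)⁻¹ • ((PLhat.graft PLhat.vertex A + (q - 1) • PLhat.vertex : PLhat K) n -
      PLhat.act (PowerSeries.exp K - 1) (Omega K) (PLhat.shift q A) n)) (by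
    intro n A B h
    simp only [Pi.add_apply]
    rw [PLhat.graft_congr (fun _ _ => rfl) h]
    congr 2
    refine Finset.sum_congr rfl fun k _ => ?_
    rcases eq_or_ne k 0 with rfl | hk
    · simp
    · rw [PLhat.iterate_congr' (fun _ _ => rfl) (fun m hm => ?_) hk]
      simp only [PLhat.shift, h m hm])
  refine (existsUnique_congr fun A => ?_).1 H
  rw [funext_iff, funext_iff]
  refine forall_congr' fun n => ?_
  rcases Nat.eq_zero_or_pos n with rfl | hn
  · exact iff_of_true ((PLhat.zero_eq _).trans (PLhat.zero_eq _).symm)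
      ((PLhat.zero_eq _).trans (PLhat.zero_eq _).symm)
  have h0 : q ^ n - 1 ≠ 0 := sub_ne_zero.2 (hq n hn)
  have e : (q ^ n - 1) • A n = q ^ n • A n - A n := by rw [sub_smul, one_smul]
  refine (inv_smul_eq_iff₀ h0).trans ?_
  refine (Eq.congr_right e).trans ?_
  simp only [Pi.add_apply, Pi.sub_apply, PLhat.shift]
  constructor
  · intro h; rw [sub_eq_iff_eq_add] at h; rw [h]; abel
  · intro h; rw [← h]; abel

end Completion

/-- The field `ℚ(q)` of rational functions in the indeterminate `q`. -/
abbrev Qq : Type := RatFunc ℚ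

/-- The indeterminate `q`. -/
noncomputable abbrev q : Qq := RatFunc.X

theorem q_pow_ne_one (n : ℕ) (hn : 0 < n) : q ^ n ≠ 1 := by
  intro h
  have h1 : (algebraMap (Polynomial ℚ) Qq) (Polynomial.X ^ n) = algebraMap (Polynomial ℚ) Qq 1 := by
    rw [map_pow, RatFunc.algebraMap_X, map_one]; exact h
  have h2 := congrArg Polynomial.natDegree (RatFunc.algebraMap_injective ℚ h1)
  rw [Polynomial.natDegree_X_pow, Polynomial.natDegree_one] at h2
  omega

/-- The series `Ω_q`, with coefficients in `ℚ(q)`. -/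
noncomputable def OmegaQ : PLhat Qq := (existsUnique_OmegaQ q_pow_ne_one).choose

/-! ### Noncommutative symmetric functions -/

/-- The algebra `Sym`: the free unital associative algebra on `S₁, S₂, …`. The generator with
index `n : ℕ` is `S_{n+1}`. -/
abbrev Sym (K : Type) [Field K] : Type := FreeAlgebra K ℕ

namespace Sym

variable (K : Type) [Field K]

/-- The elements `Sₙ`, with `S₀ = 1`. -/
noncomputable def S : ℕ → Sym K
  | 0 => 1
  | n + 1 => FreeAlgebra.ι K n

/-- The elements `Ψₙ`, determined by `n Sₙ = ∑_{0 ≤ i < n} Sᵢ Ψₙ₋ᵢ` for `n ≥ 1`;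
by convention `Ψ₀ = 0`. -/
noncomputable def Psi (n : ℕ) : Sym K :=
  (n : K) • S K n - ∑ j : Fin n, S K (n - j) * Psi j
termination_by n
decreasing_by exact j.2

theorem Psi_zero : Psi K 0 = 0 := by
  rw [Psi]; simp

theorem smul_S (n : ℕ) : (n : K) • S K n = ∑ i ∈ Finset.range n, S K i * Psi K (n - i) := by
  rcases n with _ | n
  · simp
  have h : (↑(n + 1) : K) • S K (n + 1) =
      Psi K (n + 1) + ∑ j ∈ Finset.range (n + 1), S K (n + 1 - j) * Psi K j := by
    rw [Psi, ← Fin.sum_univ_eq_sum_range (fun j => S K (n + 1 - j) * Psi K j), sub_add_cancel]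
  rw [h, Finset.sum_range_succ' (fun j => S K (n + 1 - j) * Psi K j), Psi_zero, mul_zero, add_zero,
    Finset.sum_range_succ', add_comm, ← Finset.sum_range_reflect]
  congr 1
  · refine Finset.sum_congr rfl fun j hj => ?_
    have := Finset.mem_range.1 hj
    congr 2 <;> omega
  · simp [S]

variable {K}

/-- The elements `Sₙ(A/(1-q))`. Their generating series is the infinite product
`⋯ σ(q² t) σ(q t) σ(t)`, where `σ(t) = ∑ₙ Sₙ tⁿ`; equivalently, `S₀(A/(1-q)) = 1` and
`Sₙ(A/(1-q)) = ∑_{i + j = n} qⁱ Sᵢ(A/(1-q)) Sⱼ`, which is solved here for the term `i = n`. -/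
noncomputable def Sq (q : K) : ℕ → Sym K
  | 0 => 1
  | n + 1 => (1 - q ^ (n + 1))⁻¹ • ∑ i : Fin (n + 1), q ^ (i : ℕ) • (Sq q i * S K (n + 1 - i))
termination_by n => n
decreasing_by exact i.2

theorem Sq_eq {q : K} (hq : ∀ n : ℕ, 0 < n → q ^ n ≠ 1) (n : ℕ) :
    Sq q n = ∑ p ∈ Finset.HasAntidiagonal.antidiagonal n, q ^ p.1 • (Sq q p.1 * S K p.2) := by
  rcases n with _ | n
  · simp [Sq, S]
  have h0 : 1 - q ^ (n + 1) ≠ 0 := sub_ne_zero.2 (hq _ n.succ_pos).symm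
  have h : (1 - q ^ (n + 1)) • Sq q (n + 1) =
      ∑ i ∈ Finset.range (n + 1), q ^ i • (Sq q i * S K (n + 1 - i)) := by
    rw [Sq, smul_inv_smul₀ h0,
      Fin.sum_univ_eq_sum_range (fun i => q ^ i • (Sq q i * S K (n + 1 - i)))]
  rw [Finset.Nat.sum_antidiagonal_eq_sum_range_succ (fun i j => q ^ i • (Sq q i * S K j)),
    Finset.sum_range_succ, ← h, sub_smul, one_smul, Nat.sub_self, S, mul_one, sub_add_cancel]

/-- The change of alphabet `A ↦ A/(1-q)`: the morphism of algebras with `Sₙ ↦ Sₙ(A/(1-q))`. -/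
noncomputable def changeAlphabet (q : K) : Sym K →ₐ[K] Sym K :=
  FreeAlgebra.lift K fun n => Sq q (n + 1)

/-- The elements `Ψₙ(A/(1-q))`. -/
noncomputable def PsiQ (q : K) (n : ℕ) : Sym K := changeAlphabet q (Psi K n)

theorem changeAlphabet_S (q : K) (n : ℕ) : changeAlphabet q (S K n) = Sq q n := by
  cases n with
  | zero => simp [S, Sq]
  | succ n => simp [S, changeAlphabet]

/-- The relation `∑ Ψₙ(A/(1-q)) = (∑ Sₙ)⁻¹ (∑ qⁿ Ψₙ(A/(1-q))) (∑ Sₙ) + ∑ Ψₙ`, multiplied by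
`∑ Sₙ` from the left. -/
theorem PsiQ_eq {q : K} (hq : ∀ n : ℕ, 0 < n → q ^ n ≠ 1) (n : ℕ) :
    ∑ p ∈ Finset.HasAntidiagonal.antidiagonal n, S K p.1 * PsiQ q p.2 =
      ∑ p ∈ Finset.HasAntidiagonal.antidiagonal n, q ^ p.1 • (PsiQ q p.1 * S K p.2) +
        ∑ p ∈ Finset.HasAntidiagonal.antidiagonal n, S K p.1 * Psi K p.2 := by
  have hS (n : ℕ) : (n : K) • S K n =
      ∑ p ∈ Finset.HasAntidiagonal.antidiagonal n, S K p.1 * Psi K p.2 := by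
    rw [smul_S, Finset.Nat.sum_antidiagonal_eq_sum_range_succ (fun i j => S K i * Psi K j),
      Finset.sum_range_succ, Nat.sub_self, Psi_zero, mul_zero, add_zero]
  have hQ (n : ℕ) : (n : K) • Sq q n =
      ∑ p ∈ Finset.HasAntidiagonal.antidiagonal n, Sq q p.1 * PsiQ q p.2 := by
    have := congrArg (changeAlphabet q) (hS n)
    simpa only [map_smul, map_sum, map_mul, changeAlphabet_S, PsiQ] using this
  let s : PowerSeries (Sym K) := PowerSeries.mk (S K)
  let p : PowerSeries (Sym K) := PowerSeries.mk (Psi K)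
  let sq : PowerSeries (Sym K) := PowerSeries.mk (Sq q)
  let pq : PowerSeries (Sym K) := PowerSeries.mk (PsiQ q)
  let sh : PowerSeries (Sym K) → PowerSeries (Sym K) :=
    fun f => PowerSeries.mk fun n => q ^ n • f.coeff n
  let D : PowerSeries (Sym K) → PowerSeries (Sym K) :=
    fun f => PowerSeries.mk fun n => (n : K) • f.coeff n
  have D_mul (f g : PowerSeries (Sym K)) : D (f * g) = D f * g + f * D g := by
    ext n
    simp only [D, PowerSeries.coeff_mk, map_add, PowerSeries.coeff_mul, Finset.smul_sum,
      ← Finset.sum_add_distrib]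
    refine Finset.sum_congr rfl fun x hx => ?_
    rw [← Finset.HasAntidiagonal.mem_antidiagonal.1 hx, Nat.cast_add, add_smul, smul_mul_assoc,
      mul_smul_comm]
  have sh_mul (f g : PowerSeries (Sym K)) : sh (f * g) = sh f * sh g := by
    ext n
    simp only [sh, PowerSeries.coeff_mk, PowerSeries.coeff_mul, Finset.smul_sum]
    refine Finset.sum_congr rfl fun x hx => ?_
    rw [← Finset.HasAntidiagonal.mem_antidiagonal.1 hx, pow_add, smul_mul_smul_comm]
  have D_sh (f : PowerSeries (Sym K)) : D (sh f) = sh (D f) := by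
    ext n
    simp only [D, sh, PowerSeries.coeff_mk]
    rw [smul_comm]
  have h1 : D s = s * p := by
    ext n
    simp only [D, s, p, PowerSeries.coeff_mk, PowerSeries.coeff_mul, hS]
  have h2 : D sq = sq * pq := by
    ext n
    simp only [D, sq, pq, PowerSeries.coeff_mk, PowerSeries.coeff_mul, hQ]
  have h3 : sq = sh sq * s := by
    ext n
    simp only [sh, s, sq, PowerSeries.coeff_mk, PowerSeries.coeff_mul, smul_mul_assoc]
    exact Sq_eq hq n
  have h4 : sh sq * (s * pq) = sh sq * (sh pq * s + s * p) := by
    rw [← mul_assoc, ← h3, ← h2]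
    conv_lhs => rw [h3]
    rw [D_mul, D_sh, h2, sh_mul, h1]
    noncomm_ring
  obtain ⟨u, hu⟩ : ∃ u : PowerSeries (Sym K), u * sh sq = 1 := by
    refine ⟨_, PowerSeries.invOfUnit_mul (sh sq) 1 ?_⟩
    rw [← PowerSeries.coeff_zero_eq_constantCoeff_apply]
    simp [sh, sq, Sq]
  have h6 := congrArg (fun f => PowerSeries.coeff n (u * f)) h4
  simp only [← mul_assoc u, hu, one_mul] at h6
  simpa only [sh, s, p, pq, map_add, PowerSeries.coeff_mk, PowerSeries.coeff_mul,
    smul_mul_assoc] using h6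

end Sym

/-- The left combs: `leftComb n` is the left comb `L_{n+1}` with `n + 1` inner vertices, given by
`L₁ = Y` and `L_{n+1} = Lₙ ≻ Y`. -/
noncomputable def leftComb (K : Type) [Field K] : ℕ → Dend K
  | 0 => Dend.Y
  | n + 1 => Dend.succ (leftComb K n) Dend.Y

/-- The morphism of unital algebras `θ` from `Sym` to `Dend` with a unit added, with `Sₙ ↦ Lₙ`. -/
noncomputable def theta (K : Type) [Field K] : Sym K →ₐ[K] Unitization K (Dend K) :=
  FreeAlgebra.lift K fun n => (leftComb K n : Unitization K (Dend K))

end QOmega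

namespace QOmega

open PowerSeries Finset

/-! Both sides are compared as power series in `t` over one ring with a Rota–Baxter operator. The
dendriform axioms say that `Dend` is a bimodule over `Unitization K (Dend K)`, with `≻` on the left
and `≺` on the right. In the square-zero extension `DendExt K`, the operator `R` moving the bimodule
copy of `Dend` into the algebra is Rota–Baxter of weight zero, and the pre-Lie product `x ↶ y`
becomes the commutator `R(y) x - x R(y)`. So the action of a series in `A` is a power series in the
operator `adj` of `R(A)`.

Write `y = t Y`, and `o`, `W` for the series of `Ω` and `Ω_q`. Inverting the Bernoulli series in the
equation of `Ω` shows that `e = exp(R o)` solves `e = 1 + R(y e)`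
(`IsRotaBaxter.mapCoeff_mul_expSeries`, the pre-Lie Magnus expansion). The combs `s = ∑ Lₙ tⁿ` solve
`s = 1 + R(s y)`, so `F(t) = s(-t)` solves `F = 1 - R(F y)` and is the inverse of `e`
(`IsRotaBaxter.inverse_of_eq`).

In the equation of `Ω_q`, `exp` of the adjoint operator is conjugation by `e`, so the equation reads
`e W(qt) e⁻¹ = W + [R W, y] + (q-1) y`. For `w = R W` the Rota–Baxter identity turns it into `F w =
w(qt) F - (1-q) t F'` (`IsRotaBaxter.mul_mapCoeff_eq`). On the other side, `z = (1-q) ∑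
θ(Ψₙ(A/(1-q))) tⁿ` satisfies `s z = z(qt) s + (1-q) t s'` (`thetaSeries_PsiQ`). After `t ↦ -t` the
two equations add up to `F d = d(qt) F` for `d = w + z(-t)`. As `d` has no constant term and `qⁿ ≠
1` for `n ≥ 1`, this forces `d = 0`; that is, `z = -w(-t)`, where the sign is the suspension. -/

/-! ### Power series of operators on a ring of formal power series -/

section Series

variable {K B : Type} [Field K] [Ring B] [Algebra K B]

/-- The operator `T` raises the order of formal power series by at least one. -/
def RaisesOrder (T : Module.End K B⟦X⟧) : Prop :=
  ∀ (n : ℕ) (x : B⟦X⟧), (∀ m < n, coeff m x = 0) → ∀ m < n + 1, coeff m (T x) = 0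

theorem RaisesOrder.sub {S T : Module.End K B⟦X⟧} (hS : RaisesOrder S) (hT : RaisesOrder T) :
    RaisesOrder (S - T) := fun n x hx m hm => by
  rw [LinearMap.sub_apply, map_sub, hS n x hx m hm, hT n x hx m hm, sub_zero]

theorem RaisesOrder.pow {T : Module.End K B⟦X⟧} (hT : RaisesOrder T) (k n : ℕ) (x : B⟦X⟧)
    (hx : ∀ m < n, coeff m x = 0) : ∀ m < n + k, coeff m ((T ^ k) x) = 0 := by
  induction k with
  | zero => simpa using hx
  | succ k ih =>
    intro m hm
    rw [pow_succ', Module.End.mul_apply]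
    exact hT (n + k) _ ih m (by omega)

theorem RaisesOrder.pow_apply {T : Module.End K B⟦X⟧} (hT : RaisesOrder T) {k m : ℕ} (x : B⟦X⟧)
    (hm : m < k) : coeff m ((T ^ k) x) = 0 :=
  hT.pow k 0 x (fun _ h => absurd h (Nat.not_lt_zero _)) m (by omega)

/-- The sum of a sequence of power series whose `k`-th term has order at least `k`. -/
noncomputable def seriesSum (u : ℕ → B⟦X⟧) : B⟦X⟧ :=
  PowerSeries.mk fun m => ∑ k ∈ range (m + 1), coeff m (u k)

/-- The value `∑ₖ fₖ Tᵏ x`. -/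
noncomputable def opEval (f : K⟦X⟧) (T : Module.End K B⟦X⟧) (x : B⟦X⟧) : B⟦X⟧ :=
  seriesSum fun k => coeff k f • (T ^ k) x

/-- Terms with `k > m` do not reach degree `m`, so the cutoff in the definition may be replaced by
any larger one. -/
theorem coeff_seriesSum {u : ℕ → B⟦X⟧} (hu : ∀ k, ∀ m < k, coeff m (u k) = 0) {m N : ℕ}
    (h : m < N) : coeff m (seriesSum u) = ∑ k ∈ range N, coeff m (u k) := by
  rw [seriesSum, coeff_mk]
  refine Finset.sum_subset (range_mono h) fun k _ hk => hu k m ?_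
  simpa [Nat.lt_succ_iff] using hk

theorem coeff_opEval {T : Module.End K B⟦X⟧} (hT : RaisesOrder T) (f : K⟦X⟧) (x : B⟦X⟧) {m N : ℕ}
    (h : m < N) : coeff m (opEval f T x) = coeff m (∑ k ∈ range N, coeff k f • (T ^ k) x) := by
  rw [opEval, coeff_seriesSum (fun k m hm => ?_) h, map_sum]
  rw [coeff_smul, hT.pow_apply x hm, smul_zero]

theorem opEval_add (f g : K⟦X⟧) (T : Module.End K B⟦X⟧) (x : B⟦X⟧) :
    opEval (f + g) T x = opEval f T x + opEval g T x := by
  ext m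
  simp only [opEval, seriesSum, map_add, coeff_mk, add_smul, Finset.sum_add_distrib]

theorem opEval_one (T : Module.End K B⟦X⟧) (x : B⟦X⟧) : opEval 1 T x = x := by
  ext m
  rw [opEval, seriesSum, coeff_mk, Finset.sum_range_succ', Finset.sum_eq_zero]
  · simp
  · intro k _
    simp [coeff_one]

/-- Allows an inner `opEval` to be replaced by a finite truncation under the outer operator. -/
theorem RaisesOrder.pow_congr {T : Module.End K B⟦X⟧} (hT : RaisesOrder T) (k : ℕ) {m : ℕ}
    {x x' : B⟦X⟧} (h : ∀ j < m + 1, coeff j x = coeff j x') :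
    coeff m ((T ^ k) x) = coeff m ((T ^ k) x') := by
  rw [← sub_eq_zero, ← map_sub, ← map_sub]
  exact hT.pow k (m + 1) _ (fun j hj => by rw [map_sub, h j hj, sub_self]) m (by omega)

/-- The triangle `k + l < N` and the square differ only by pairs at which `F` vanishes. -/
theorem sum_range_antidiagonal {M : Type} [AddCommMonoid M] (N : ℕ) (F : ℕ × ℕ → M)
    (hF : ∀ p : ℕ × ℕ, N ≤ p.1 + p.2 → F p = 0) :
    ∑ n ∈ range N, ∑ p ∈ HasAntidiagonal.antidiagonal n, F p =
      ∑ k ∈ range N, ∑ l ∈ range N, F (k, l) := by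
  rw [← Finset.sum_product', Finset.sum_sigma']
  refine Finset.sum_of_injOn (fun x => x.2) ?_ ?_ ?_ ?_
  · rintro ⟨n, p⟩ hx ⟨n', p'⟩ hx' h
    simp only [coe_sigma, Set.mem_sigma_iff, mem_coe,
      HasAntidiagonal.mem_antidiagonal] at hx hx' h
    obtain rfl := h
    obtain rfl := hx.2.symm.trans hx'.2
    rfl
  · rintro ⟨n, p⟩ hx
    simp only [coe_sigma, Set.mem_sigma_iff, mem_coe,
      HasAntidiagonal.mem_antidiagonal, mem_range] at hx
    simp only [coe_product, Set.mem_prod, mem_coe, mem_range]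
    omega
  · intro p _ hp
    refine hF p (not_lt.1 fun h => hp ⟨⟨p.1 + p.2, p⟩, ?_, rfl⟩)
    simp [h]
  · intros; rfl

/-- The Cauchy product of power series of operators. -/
theorem opEval_opEval {S T : Module.End K B⟦X⟧} (hS : RaisesOrder S) (hT : RaisesOrder T)
    (f g : K⟦X⟧) (x : B⟦X⟧) :
    opEval f S (opEval g T x) = seriesSum fun n => ∑ p ∈ HasAntidiagonal.antidiagonal n,
      (coeff p.1 f * coeff p.2 g) • (S ^ p.1) ((T ^ p.2) x) := by
  ext m
  simp only [seriesSum, coeff_mk, map_sum]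
  rw [sum_range_antidiagonal]
  · rw [coeff_opEval hS f _ (Nat.lt_succ_self m), map_sum]
    refine Finset.sum_congr rfl fun k _ => ?_
    rw [coeff_smul, hS.pow_congr k fun j hj => coeff_opEval hT g x hj, map_sum, map_sum,
      Finset.smul_sum]
    refine Finset.sum_congr rfl fun l _ => ?_
    rw [map_smul, coeff_smul, coeff_smul, smul_smul]
  -- Outside the triangle, `S ^ p.1` after `T ^ p.2` raises the order beyond `m`.
  · intro p hp
    rw [coeff_smul, hS.pow p.1 p.2 _ (fun i hi => hT.pow_apply x hi) m (by omega), smul_zero]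

theorem opEval_mul {T : Module.End K B⟦X⟧} (hT : RaisesOrder T) (f g : K⟦X⟧) (x : B⟦X⟧) :
    opEval f T (opEval g T x) = opEval (f * g) T x := by
  rw [opEval_opEval hT hT, opEval]
  congr 1
  funext n
  rw [coeff_mul, Finset.sum_smul]
  refine Finset.sum_congr rfl fun p hp => ?_
  rw [← Module.End.mul_apply, ← pow_add, HasAntidiagonal.mem_antidiagonal.1 hp]

/-! ### Multiplication operators, the adjoint operator and exponentials. -/

/-- Left multiplication. -/
noncomputable def mulL (K : Type) {B : Type} [Field K] [Ring B] [Algebra K B] (a : B⟦X⟧) :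
    Module.End K B⟦X⟧ := LinearMap.mulLeft K a

/-- Right multiplication. -/
noncomputable def mulR (K : Type) {B : Type} [Field K] [Ring B] [Algebra K B] (a : B⟦X⟧) :
    Module.End K B⟦X⟧ := LinearMap.mulRight K a

variable {a : B⟦X⟧}

theorem mulL_apply (a x : B⟦X⟧) : mulL K a x = a * x := rfl

theorem mulR_apply (a x : B⟦X⟧) : mulR K a x = x * a := rfl

theorem mulL_pow_apply (a x : B⟦X⟧) (n : ℕ) : (mulL K a ^ n) x = a ^ n * x := by
  rw [mulL, LinearMap.pow_mulLeft]; rfl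

theorem mulR_pow_apply (a x : B⟦X⟧) (n : ℕ) : (mulR K a ^ n) x = x * a ^ n := by
  rw [mulR, LinearMap.pow_mulRight]; rfl

theorem commute_mulL_mulR (a b : B⟦X⟧) : Commute (mulL K a) (mulR K b) :=
  LinearMap.ext fun x => (mul_assoc a x b).symm

theorem raisesOrder_mulL (ha : coeff 0 a = 0) : RaisesOrder (mulL K a) := by
  intro n x hx m hm
  rw [mulL_apply, coeff_mul]
  refine Finset.sum_eq_zero fun p hp => ?_
  have := HasAntidiagonal.mem_antidiagonal.1 hp
  rcases Nat.eq_zero_or_pos p.1 with h | h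
  · rw [h, ha, zero_mul]
  · rw [hx p.2 (by omega), mul_zero]

theorem raisesOrder_mulR (ha : coeff 0 a = 0) : RaisesOrder (mulR K a) := by
  intro n x hx m hm
  rw [mulR_apply, coeff_mul]
  refine Finset.sum_eq_zero fun p hp => ?_
  have := HasAntidiagonal.mem_antidiagonal.1 hp
  rcases Nat.eq_zero_or_pos p.2 with h | h
  · rw [h, ha, mul_zero]
  · rw [hx p.1 (by omega), zero_mul]

/-- The operator `x ↦ a x - x a`. -/
noncomputable def adj (K : Type) {B : Type} [Field K] [Ring B] [Algebra K B] (a : B⟦X⟧) :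
    Module.End K B⟦X⟧ := mulL K a - mulR K a

theorem adj_apply (a x : B⟦X⟧) : adj K a x = a * x - x * a := rfl

theorem raisesOrder_adj (ha : coeff 0 a = 0) : RaisesOrder (adj K a) :=
  (raisesOrder_mulL ha).sub (raisesOrder_mulR ha)

theorem commute_mulR_adj (a : B⟦X⟧) : Commute (mulR K a) (adj K a) :=
  (commute_mulL_mulR a a).symm.sub_right (Commute.refl _)

theorem mulR_add_adj (a : B⟦X⟧) : mulR K a + adj K a = mulL K a := by rw [adj]; abel

/-- The exponential of a power series without constant term. -/
noncomputable def expSeries (K : Type) {B : Type} [Field K] [Algebra ℚ K] [Ring B] [Algebra K B]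
    (a : B⟦X⟧) : B⟦X⟧ :=
  opEval (PowerSeries.exp K) (mulL K a) 1

/-- The element `opEval f (mulL K a) 1` plays the role of `f(a)`. Up to degree `m` it is a
polynomial in `a`, for which the claim is distributivity. -/
theorem opEval_mulL_mul (f : K⟦X⟧) (ha : coeff 0 a = 0) (x : B⟦X⟧) :
    opEval f (mulL K a) x = opEval f (mulL K a) 1 * x := by
  ext m
  have h : ∀ p ∈ HasAntidiagonal.antidiagonal m, coeff p.1 (opEval f (mulL K a) 1) * coeff p.2 x =
      coeff p.1 (∑ k ∈ range (m + 1), coeff k f • (mulL K a ^ k) 1) * coeff p.2 x := by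
    intro p hp
    rw [coeff_opEval (raisesOrder_mulL ha) f 1 (N := m + 1)]
    have := HasAntidiagonal.mem_antidiagonal.1 hp
    omega
  rw [coeff_mul, Finset.sum_congr rfl h, ← coeff_mul,
    coeff_opEval (raisesOrder_mulL ha) f x (Nat.lt_succ_self m), Finset.sum_mul]
  simp only [mulL_pow_apply, mul_one, smul_mul_assoc]

theorem opEval_mulR_mul (f : K⟦X⟧) (ha : coeff 0 a = 0) (x : B⟦X⟧) :
    opEval f (mulR K a) x = x * opEval f (mulL K a) 1 := by
  ext m
  have h : ∀ p ∈ HasAntidiagonal.antidiagonal m, coeff p.1 x * coeff p.2 (opEval f (mulL K a) 1) =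
      coeff p.1 x * coeff p.2 (∑ k ∈ range (m + 1), coeff k f • (mulL K a ^ k) 1) := by
    intro p hp
    rw [coeff_opEval (raisesOrder_mulL ha) f 1 (N := m + 1)]
    have := HasAntidiagonal.mem_antidiagonal.1 hp
    omega
  rw [coeff_mul, Finset.sum_congr rfl h, ← coeff_mul,
    coeff_opEval (raisesOrder_mulR ha) f x (Nat.lt_succ_self m), Finset.mul_sum]
  simp only [mulL_pow_apply, mulR_pow_apply, mul_one, mul_smul_comm]

variable (K) in
/-- The power series `(exp z - 1) / z`. -/
noncomputable def expSubOneDiv : K⟦X⟧ := PowerSeries.mk fun n => ((n + 1).factorial : K)⁻¹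

theorem coeff_expSubOneDiv (n : ℕ) : coeff n (expSubOneDiv K) = ((n + 1).factorial : K)⁻¹ :=
  coeff_mk _ _

/-- The sums `∑_{i + j = n} aⁱ o aʲ`. -/
noncomputable def twoSided (a o : B⟦X⟧) : ℕ → B⟦X⟧
  | 0 => o
  | n + 1 => a ^ (n + 1) * o + twoSided a o n * a

/-- With the commuting operators `L = mulL K a`, `R = mulR K a` and `D = L - R`, the sum is formally
`(Lⁿ⁺¹ - Rⁿ⁺¹) / (L - R) = ((R + D)ⁿ⁺¹ - Rⁿ⁺¹) / D`. This explains the binomials of `n + 1` against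
exponents of total degree `n`. -/
theorem twoSided_eq (a o : B⟦X⟧) (n : ℕ) :
    twoSided a o n = ∑ p ∈ HasAntidiagonal.antidiagonal n,
      ((n + 1).choose p.1 : K) • (mulR K a ^ p.1) ((adj K a ^ p.2) o) := by
  induction n with
  | zero => simp [twoSided]
  | succ n ih =>
    have h : a ^ (n + 1) * o = ∑ p ∈ HasAntidiagonal.antidiagonal (n + 1),
        ((n + 1).choose p.1 : K) • (mulR K a ^ p.1) ((adj K a ^ p.2) o) := by
      rw [← mulL_pow_apply (K := K), ← mulR_add_adj, (commute_mulR_adj a).add_pow',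
        LinearMap.sum_apply]
      refine Finset.sum_congr rfl fun p _ => ?_
      rw [LinearMap.smul_apply, Module.End.mul_apply, ← Nat.cast_smul_eq_nsmul K]
    -- The terms with `p.1 = 0` agree. In the others, right multiplication by `a` shifts `p.1` by
    -- one, and Pascal's rule combines the two sums.
    rw [twoSided, h, ih, Finset.Nat.sum_antidiagonal_succ, Finset.Nat.sum_antidiagonal_succ,
      add_assoc, Finset.sum_mul, ← Finset.sum_add_distrib]
    refine congrArg₂ _ (by simp) ?_
    refine Finset.sum_congr rfl fun p _ => ?_
    have e : (mulR K a ^ p.1) ((adj K a ^ p.2) o) * a =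
        (mulR K a ^ (p.1 + 1)) ((adj K a ^ p.2) o) := by
      rw [pow_succ', Module.End.mul_apply, mulR_apply]
    rw [smul_mul_assoc, e,
      Nat.choose_succ_succ' (n + 1) p.1, Nat.cast_add, add_smul, add_comm]

variable [Algebra ℚ K]

theorem factorial_ne_zero' (n : ℕ) : (n.factorial : K) ≠ 0 := by
  have := algebraRat.charZero K
  exact_mod_cast n.factorial_ne_zero

theorem coeff_exp' (n : ℕ) : coeff n (PowerSeries.exp K) = (n.factorial : K)⁻¹ := by
  simp [coeff_exp]

/-- Conjugation by an exponential is the exponential of the adjoint operator. -/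
theorem opEval_exp_adj_mul (ha : coeff 0 a = 0) (x : B⟦X⟧) :
    opEval (PowerSeries.exp K) (adj K a) x * expSeries K a = expSeries K a * x := by
  rw [expSeries, ← opEval_mulL_mul _ ha, ← opEval_mulR_mul _ ha,
    opEval_opEval (raisesOrder_mulR ha) (raisesOrder_adj ha), opEval]
  congr 1
  funext n
  -- `exp L = exp R · exp D` for the commuting operators `R` and `D` with `L = R + D`, compared
  -- degree by degree.
  rw [← mulR_add_adj, (commute_mulR_adj a).add_pow', LinearMap.sum_apply, Finset.smul_sum]
  refine Finset.sum_congr rfl fun p hp => ?_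
  rw [LinearMap.smul_apply, Module.End.mul_apply, ← Nat.cast_smul_eq_nsmul K, smul_smul]
  congr 1
  have e := HasAntidiagonal.mem_antidiagonal.1 hp
  have h := Nat.add_choose_mul_factorial_mul_factorial p.2 p.1
  rw [add_comm, e, mul_right_comm] at h
  have h' : ((n.choose p.1 : ℕ) : K) * p.1.factorial * p.2.factorial = n.factorial := by
    simpa only [Nat.cast_mul] using congrArg (Nat.cast : ℕ → K) h
  simp only [coeff_exp']
  have h1 := factorial_ne_zero' (K := K) p.1
  have h2 := factorial_ne_zero' (K := K) p.2
  have h3 := factorial_ne_zero' (K := K) n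
  field_simp
  rw [← h']; ring

/-- The Bernoulli series is `z / (exp z - 1)`; one cancels `X` in its defining relation. This
inverts the equation of `Ω`. -/
theorem expSubOneDiv_mul_bernoulli : expSubOneDiv K * bernoulliPowerSeries K = 1 := by
  have h : PowerSeries.exp K - 1 = expSubOneDiv K * X := by
    ext n
    cases n with
    | zero => simp
    | succ n => rw [coeff_succ_mul_X, map_sub, coeff_exp', coeff_expSubOneDiv, coeff_one]; simp
  have := bernoulliPowerSeries_mul_exp_sub_one K
  rw [h, ← mul_assoc] at this
  rw [mul_comm]
  exact mul_right_cancel₀ X_ne_zero (this.trans (one_mul _).symm)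

/-- Right multiplication by `exp a` is `exp R`, and `1 / (i! (j+1)!)` with `i + j = n` is `1 /
(n+1)!` times the binomial of `twoSided_eq`. The two-sided sums are exactly what a Rota–Baxter
operator integrates to powers. -/
theorem opEval_expSubOneDiv_mul (ha : coeff 0 a = 0) (o : B⟦X⟧) :
    opEval (expSubOneDiv K) (adj K a) o * expSeries K a =
      seriesSum fun n => ((n + 1).factorial : K)⁻¹ • twoSided a o n := by
  rw [expSeries, ← opEval_mulR_mul _ ha,
    opEval_opEval (raisesOrder_mulR ha) (raisesOrder_adj ha)]
  congr 1
  funext n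
  rw [twoSided_eq (K := K), Finset.smul_sum]
  refine Finset.sum_congr rfl fun p hp => ?_
  rw [smul_smul]
  congr 1
  have e := HasAntidiagonal.mem_antidiagonal.1 hp
  have h := Nat.add_choose_mul_factorial_mul_factorial (p.2 + 1) p.1
  rw [add_comm, ← add_assoc, e, mul_right_comm] at h
  have h' : (((n + 1).choose p.1 : ℕ) : K) * p.1.factorial * (p.2 + 1).factorial =
      (n + 1).factorial := by
    simpa only [Nat.cast_mul] using congrArg (Nat.cast : ℕ → K) h
  rw [coeff_exp', coeff_expSubOneDiv]
  have h1 := factorial_ne_zero' (K := K) p.1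
  have h2 := factorial_ne_zero' (K := K) (p.2 + 1)
  have h3 := factorial_ne_zero' (K := K) (n + 1)
  field_simp
  rw [← h']; ring

end Series

/-! ### Rota–Baxter operators on formal power series -/

section RotaBaxter

variable {K B : Type} [Field K] [Ring B] [Algebra K B]

/-- The coefficientwise extension of a linear operator to power series. -/
noncomputable def mapCoeff (R : B →ₗ[K] B) : B⟦X⟧ →ₗ[K] B⟦X⟧ where
  toFun x := PowerSeries.mk fun n => R (coeff n x)
  map_add' x y := by ext n; simp
  map_smul' c x := by ext n; simp

theorem coeff_mapCoeff (R : B →ₗ[K] B) (n : ℕ) (x : B⟦X⟧) :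
    coeff n (mapCoeff R x) = R (coeff n x) := by
  simp [mapCoeff]

/-- The identity of Rota–Baxter operators of weight zero. -/
def IsRotaBaxter (R : B →ₗ[K] B) : Prop := ∀ x y, R x * R y = R (x * R y + R x * y)

variable {R : B →ₗ[K] B}

theorem IsRotaBaxter.mapCoeff_mul (hR : IsRotaBaxter R) (x y : B⟦X⟧) :
    mapCoeff R x * mapCoeff R y =
      mapCoeff R (x * mapCoeff R y) + mapCoeff R (mapCoeff R x * y) := by
  rw [← map_add]
  ext n
  rw [coeff_mapCoeff, map_add, coeff_mul, coeff_mul, coeff_mul, ← Finset.sum_add_distrib, map_sum]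
  simp only [coeff_mapCoeff]
  exact Finset.sum_congr rfl fun p _ => hR _ _

/-! ### Dilations and the Euler derivation. -/

/-- The substitution `t ↦ c t`. -/
noncomputable def dilate (c : K) : B⟦X⟧ →ₗ[K] B⟦X⟧ where
  toFun x := PowerSeries.mk fun n => c ^ n • coeff n x
  map_add' x y := by ext n; simp
  map_smul' d x := by
    ext n
    simp only [coeff_mk, coeff_smul, RingHom.id_apply]
    rw [smul_comm]

theorem coeff_dilate (c : K) (n : ℕ) (x : B⟦X⟧) : coeff n (dilate c x) = c ^ n • coeff n x := by
  simp [dilate]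

theorem dilate_mul (c : K) (x y : B⟦X⟧) : dilate c (x * y) = dilate c x * dilate c y := by
  ext n
  simp only [coeff_dilate, coeff_mul, Finset.smul_sum]
  refine Finset.sum_congr rfl fun p hp => ?_
  rw [← HasAntidiagonal.mem_antidiagonal.1 hp, pow_add, smul_mul_smul_comm]

theorem dilate_one (c : K) : dilate c (1 : B⟦X⟧) = 1 := by
  ext n
  rw [coeff_dilate, coeff_one]
  split_ifs with h <;> simp [h]

theorem dilate_dilate (c d : K) (x : B⟦X⟧) : dilate c (dilate d x) = dilate d (dilate c x) := by
  ext n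
  simp only [coeff_dilate]
  rw [smul_comm]

theorem mapCoeff_dilate (c : K) (x : B⟦X⟧) : mapCoeff R (dilate c x) = dilate c (mapCoeff R x) := by
  ext n
  simp only [coeff_dilate, coeff_mapCoeff, map_smul]

variable (K) in
/-- The Euler derivation `t d/dt`. -/
noncomputable def euler : B⟦X⟧ →ₗ[K] B⟦X⟧ where
  toFun x := PowerSeries.mk fun n => (n : K) • coeff n x
  map_add' x y := by ext n; simp
  map_smul' d x := by
    ext n
    simp only [coeff_mk, coeff_smul, RingHom.id_apply]
    rw [smul_comm]

theorem coeff_euler (n : ℕ) (x : B⟦X⟧) : coeff n (euler K x) = (n : K) • coeff n x := by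
  simp [euler]

theorem euler_mul (x y : B⟦X⟧) : euler K (x * y) = euler K x * y + x * euler K y := by
  ext n
  simp only [coeff_euler, map_add, coeff_mul, Finset.smul_sum, ← Finset.sum_add_distrib]
  refine Finset.sum_congr rfl fun p hp => ?_
  rw [← HasAntidiagonal.mem_antidiagonal.1 hp, Nat.cast_add, add_smul, smul_mul_assoc,
    mul_smul_comm]

theorem euler_one : euler K (1 : B⟦X⟧) = 0 := by
  ext n
  rw [coeff_euler, coeff_one]
  split_ifs with h <;> simp [h]

theorem euler_dilate (c : K) (x : B⟦X⟧) : euler K (dilate c x) = dilate c (euler K x) := by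
  ext n
  simp only [coeff_dilate, coeff_euler]
  rw [smul_comm]

theorem mapCoeff_euler (x : B⟦X⟧) : mapCoeff R (euler K x) = euler K (mapCoeff R x) := by
  ext n
  simp only [coeff_euler, coeff_mapCoeff, map_smul]

theorem dilate_of_linear {y : B⟦X⟧} (hy : ∀ n, n ≠ 1 → coeff n y = 0) (c : K) :
    dilate c y = c • y := by
  ext n
  rw [coeff_dilate, coeff_smul]
  by_cases h : n = 1
  · rw [h, pow_one]
  · rw [hy n h, smul_zero, smul_zero]

theorem euler_of_linear {y : B⟦X⟧} (hy : ∀ n, n ≠ 1 → coeff n y = 0) : euler K y = y := by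
  ext n
  rw [coeff_euler]
  by_cases h : n = 1
  · rw [h, Nat.cast_one, one_smul]
  · rw [hy n h, smul_zero]

/-! ### Linear equations with a Rota–Baxter operator. -/

/-- The equation `V = - R (V y)` has only the trivial solution. -/
theorem eq_zero_of_add_mapCoeff_mul {y V : B⟦X⟧} (hy : coeff 0 y = 0)
    (hV : V + mapCoeff R (V * y) = 0) : V = 0 := by
  ext n
  induction n using Nat.strong_induction_on with
  | _ n ih =>
    have h := congrArg (coeff n) hV
    rw [map_add, coeff_mapCoeff, coeff_mul, Finset.sum_eq_zero, map_zero, add_zero] at h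
    · exact h
    intro p hp
    have := HasAntidiagonal.mem_antidiagonal.1 hp
    rcases Nat.eq_zero_or_pos p.2 with h' | h'
    · rw [h', hy, mul_zero]
    · rw [ih p.1 (by omega), map_zero, zero_mul]

theorem IsRotaBaxter.mapCoeff_twoSided (hR : IsRotaBaxter R) (o : B⟦X⟧) (n : ℕ) :
    mapCoeff R (twoSided (mapCoeff R o) o n) = mapCoeff R o ^ (n + 1) := by
  induction n with
  | zero => simp [twoSided]
  | succ n ih =>
    -- The Rota–Baxter identity for `R(twoSided n) · R(o)` yields exactly the two summands of the
    -- recursion for `twoSided`.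
    rw [twoSided, map_add, pow_succ _ (n + 1), ← ih, hR.mapCoeff_mul, add_comm]

/-- The solutions of `e = 1 + R (y e)` and `F = 1 - R (F y)` are inverse to each other. -/
theorem IsRotaBaxter.inverse_of_eq (hR : IsRotaBaxter R) {y e F : B⟦X⟧} (hy : coeff 0 y = 0)
    (he : e = 1 + mapCoeff R (y * e)) (hF : F = 1 - mapCoeff R (F * y)) :
    F * e = 1 ∧ e * F = 1 := by
  have h1 : mapCoeff R (y * e) = e - 1 := by rw [eq_sub_iff_add_eq, add_comm]; exact he.symm
  have h2 : mapCoeff R (F * y) = 1 - F := by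
    rw [eq_sub_iff_add_eq, add_comm, ← eq_sub_iff_add_eq]; exact hF
  -- The left side is `(1 - F)(e - 1)`; on the right the terms `R(F y e)` cancel, which leaves `F e
  -- = 1`.
  have h3 := hR.mapCoeff_mul (F * y) (y * e)
  have h4 : F * e = 1 := by
    have e1 : F * y * (e - 1) = F * (y * e) - F * y := by noncomm_ring
    have e2 : (1 - F) * (y * e) = y * e - F * (y * e) := by noncomm_ring
    rw [h1, h2, e1, e2, map_sub, map_sub, h1, h2] at h3
    have e3 : (1 - F) * (e - 1) = e - 1 + F - F * e := by noncomm_ring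
    rw [e3, sub_eq_iff_eq_add] at h3
    have e4 := sub_eq_iff_eq_add'.2 h3
    rw [← sub_eq_zero] at e4 ⊢
    rw [← neg_eq_zero, ← e4]
    abel
  refine ⟨h4, ?_⟩
  -- The constant term of `e` is `1`, so `e` has a right inverse, which must then be its left
  -- inverse `F`.
  have hc : coeff 0 e = ((1 : Bˣ) : B) := by
    rw [he, map_add, coeff_mapCoeff, coeff_mul]
    simp [hy]
  have h5 := PowerSeries.mul_invOfUnit e 1 (by rwa [coeff_zero_eq_constantCoeff_apply] at hc)
  have h6 : F = e.invOfUnit 1 := by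
    rw [← mul_one F, ← h5, ← mul_assoc, h4, one_mul]
  rw [h6, h5]

/-- The equation satisfied by `R W` when `e W[q] = (W + [R W, y] + (q - 1) y) e`. -/
theorem IsRotaBaxter.mul_mapCoeff_eq (hR : IsRotaBaxter R) {y e F W : B⟦X⟧} {q : K}
    (hy : ∀ n, n ≠ 1 → coeff n y = 0)
    (he : e = 1 + mapCoeff R (y * e)) (hF : F = 1 - mapCoeff R (F * y))
    (hW : e * dilate q W =
      (W + (mapCoeff R W * y - y * mapCoeff R W) + (q - 1) • y) * e) :
    F * mapCoeff R W = dilate q (mapCoeff R W) * F - (1 - q) • euler K F := by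
  obtain ⟨hFe, heF⟩ := hR.inverse_of_eq (hy 0 zero_ne_one) he hF
  have h2 : mapCoeff R (F * y) = 1 - F := by
    rw [eq_sub_iff_add_eq, add_comm, ← eq_sub_iff_add_eq]; exact hF
  rw [← mapCoeff_dilate]
  set w := mapCoeff R W with hw
  set Q := dilate q W with hQ
  -- Multiply `hW` by `F = e⁻¹` on both sides.
  have h3 : Q * F = F * W + F * w * y - F * y * w + (q - 1) • (F * y) := by
    calc Q * F = F * (e * Q) * F := by rw [← mul_assoc, hFe, one_mul]
      _ = F * (W + (w * y - y * w) + (q - 1) • y) * (e * F) := by rw [hW]; noncomm_ring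
      _ = _ := by rw [heF, mul_one, mul_add, mul_smul_comm]; noncomm_ring
  -- Rota–Baxter for `R(F y) R(W)` with `R(F y) = 1 - F`; this absorbs two of the terms of `h3`
  -- after applying `R`.
  have h4 : F * w = mapCoeff R (F * W) - mapCoeff R (F * y * w) := by
    have := hR.mapCoeff_mul (F * y) W
    rw [h2, sub_mul, sub_mul, one_mul, one_mul, map_sub, ← hw] at this
    rw [← sub_eq_zero] at this ⊢
    rw [← neg_eq_zero, ← this]
    abel
  have h5 : mapCoeff R (Q * F) = F * w + mapCoeff R (F * w * y) + (q - 1) • (1 - F) := by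
    rw [h3, h4]
    simp only [map_add, map_sub, map_smul, h2]
    abel
  have h6 : mapCoeff R Q * F = mapCoeff R (Q * F) - mapCoeff R (mapCoeff R Q * F * y) := by
    have := hR.mapCoeff_mul Q (F * y)
    rw [h2, mul_sub, mul_sub, mul_one, mul_one, map_sub] at this
    rw [← sub_eq_zero] at this ⊢
    rw [← neg_eq_zero, ← this, mul_assoc]
    abel
  -- Differentiate `F = 1 - R(F y)`; the Euler derivation fixes `y`, which is of degree one.
  have h7 : euler K F = - mapCoeff R (euler K F * y) - (1 - F) := by
    conv_lhs => rw [hF]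
    rw [map_sub, euler_one, ← mapCoeff_euler, euler_mul, euler_of_linear hy, map_add, h2]
    abel
  rw [← sub_eq_zero]
  -- The difference `V` of the two sides satisfies `V + R(V y) = 0`: the inhomogeneous terms `(q -
  -- 1)(1 - F)` of `h5` and `1 - F` of `h7` cancel.
  refine eq_zero_of_add_mapCoeff_mul (R := R) (hy 0 zero_ne_one) ?_
  have h8 : mapCoeff R (F * w * y) = mapCoeff R (Q * F) - F * w - (q - 1) • (1 - F) := by
    rw [h5]; abel
  have h9 : mapCoeff R (mapCoeff R Q * F * y) = mapCoeff R (Q * F) - mapCoeff R Q * F :=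
    eq_sub_of_add_eq' (eq_sub_iff_add_eq.1 h6)
  have h10 : mapCoeff R (euler K F * y) = - euler K F - (1 - F) := by
    conv_rhs => rw [h7]
    abel
  rw [sub_mul, sub_mul, smul_mul_assoc, map_sub, map_sub, map_smul, h8, h9, h10]
  module

/-- Once the lower coefficients of `d` vanish, degree `n` of the equation reads `dₙ = qⁿ dₙ`. -/
theorem eq_zero_of_mul_eq_dilate_mul {q : K} (hq : ∀ n : ℕ, 0 < n → q ^ n ≠ 1) {F d : B⟦X⟧}
    (hF : coeff 0 F = 1) (hd : coeff 0 d = 0) (h : F * d = dilate q d * F) : d = 0 := by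
  ext n
  induction n using Nat.strong_induction_on with
  | _ n ih =>
    rcases Nat.eq_zero_or_pos n with rfl | hn
    · rw [hd, map_zero]
    have e := congrArg (coeff n) h
    rw [coeff_mul, coeff_mul, Finset.sum_eq_single (0, n), Finset.sum_eq_single (n, 0)] at e
    · simp only [hF, one_mul, mul_one, coeff_dilate] at e
      have e' : (1 - q ^ n) • coeff n d = 0 := by rw [sub_smul, one_smul, ← e, sub_self]
      rw [map_zero]
      exact (smul_eq_zero.1 e').resolve_left (sub_ne_zero.2 (hq n hn).symm)
    · intro p hp hne
      have := HasAntidiagonal.mem_antidiagonal.1 hp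
      rw [coeff_dilate, ih p.1 (lt_of_le_of_ne (by omega) fun h' => hne ?_), map_zero, smul_zero,
        zero_mul]
      exact Prod.ext h' (show p.2 = 0 by omega)
    · simp
    · intro p hp hne
      have := HasAntidiagonal.mem_antidiagonal.1 hp
      rw [ih p.2 (lt_of_le_of_ne (by omega) fun h' => hne ?_), map_zero, mul_zero]
      exact Prod.ext (show p.1 = 0 by omega) h'
    · simp

/-! ### The Magnus expansion and the comparison of the two `q`-difference equations. -/

variable [Algebra ℚ K]

/-- The pre-Lie Magnus expansion: if `y ↶ (o / (exp o - 1)) = o`, then the exponential `e` of `R o`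
solves `e = 1 + R (y e)`. -/
theorem IsRotaBaxter.mapCoeff_mul_expSeries (hR : IsRotaBaxter R) {y o : B⟦X⟧}
    (ho : coeff 0 o = 0)
    (h : opEval (bernoulliPowerSeries K) (adj K (mapCoeff R o)) y = o) :
    expSeries K (mapCoeff R o) = 1 + mapCoeff R (y * expSeries K (mapCoeff R o)) := by
  have ha : coeff 0 (mapCoeff R o) = 0 := by rw [coeff_mapCoeff, ho, map_zero]
  have hy : y = opEval (expSubOneDiv K) (adj K (mapCoeff R o)) o := by
    have e := opEval_mul (raisesOrder_adj ha) (expSubOneDiv K) (bernoulliPowerSeries K) y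
    rw [h, expSubOneDiv_mul_bernoulli, opEval_one] at e
    exact e.symm
  have e : y * expSeries K (mapCoeff R o) = _ :=
    (congrArg (· * expSeries K (mapCoeff R o)) hy).trans (opEval_expSubOneDiv_mul ha o)
  ext m
  -- The exponential is cut at `m + 2` terms: its term of index `0` is the summand `1`, and its term
  -- of index `k + 1` is `R` of the `k`-th two-sided sum.
  rw [e, map_add, coeff_mapCoeff, seriesSum, coeff_mk, expSeries,
    coeff_opEval (raisesOrder_mulL ha) _ _ (show m < m + 1 + 1 by omega), Finset.sum_range_succ',
    add_comm, map_add]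
  congr 1
  · simp
  rw [map_sum, map_sum]
  refine Finset.sum_congr rfl fun k _ => ?_
  rw [coeff_smul, coeff_smul, map_smul, ← coeff_mapCoeff, hR.mapCoeff_twoSided, coeff_exp',
    mulL_pow_apply, mul_one]

/-- The proposition in abstract form: `y`, `o`, `W` stand for the series of `∙`, `Ω`, `Ω_q`, while
`s` and `z` stand for those of the left combs and of `(1-q) Ψₙ(A/(1-q))`. -/
theorem IsRotaBaxter.eq_neg_dilate (hR : IsRotaBaxter R) {q : K}
    (hq : ∀ n : ℕ, 0 < n → q ^ n ≠ 1) {y o W s z : B⟦X⟧}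
    (hy : ∀ n, n ≠ 1 → coeff n y = 0) (ho : coeff 0 o = 0) (hW0 : coeff 0 W = 0)
    (hz0 : coeff 0 z = 0)
    (h : opEval (bernoulliPowerSeries K) (adj K (mapCoeff R o)) y = o)
    (hW : opEval (PowerSeries.exp K - 1) (adj K (mapCoeff R o)) (dilate q W) + dilate q W - W =
      adj K (mapCoeff R W) y + (q - 1) • y)
    (hs : s = 1 + mapCoeff R (s * y))
    (hz : s * z = dilate q z * s + (1 - q) • euler K s) :
    z = - dilate (-1 : K) (mapCoeff R W) := by
  have ha : coeff 0 (mapCoeff R o) = 0 := by rw [coeff_mapCoeff, ho, map_zero]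
  set e := expSeries K (mapCoeff R o)
  have he : e = 1 + mapCoeff R (y * e) := hR.mapCoeff_mul_expSeries ho h
  -- The substitution `t ↦ -t` changes the sign of the linear series `y`.
  have hF : dilate (-1 : K) s = 1 - mapCoeff R (dilate (-1 : K) s * y) := by
    conv_lhs => rw [hs]
    rw [map_add, dilate_one, ← mapCoeff_dilate, dilate_mul, dilate_of_linear hy, neg_one_smul,
      mul_neg, map_neg, sub_eq_add_neg]
  have hW' : e * dilate q W =
      (W + (mapCoeff R W * y - y * mapCoeff R W) + (q - 1) • y) * e := by
    rw [← opEval_exp_adj_mul ha]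
    congr 1
    have e1 := opEval_add (PowerSeries.exp K - 1) 1 (adj K (mapCoeff R o)) (dilate q W)
    rw [sub_add_cancel, opEval_one] at e1
    rw [sub_eq_iff_eq_add, adj_apply] at hW
    rw [e1, hW]
    abel
  have key := hR.mul_mapCoeff_eq hy he hF hW'
  have hz' := congrArg (dilate (-1 : K)) hz
  rw [dilate_mul, map_add, dilate_mul, map_smul, ← euler_dilate, dilate_dilate] at hz'
  -- The Euler terms of `key` and `hz'` have opposite signs and cancel in the sum.
  have hd := eq_zero_of_mul_eq_dilate_mul hq (F := dilate (-1 : K) s)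
    (d := mapCoeff R W + dilate (-1 : K) z) ?_ ?_ ?_
  · have := congrArg (dilate (-1 : K)) hd
    rw [map_add, map_zero] at this
    have e2 : dilate (-1 : K) (dilate (-1 : K) z) = z := by
      ext n
      rw [coeff_dilate, coeff_dilate, smul_smul, ← mul_pow]
      simp
    rw [e2] at this
    exact eq_neg_of_add_eq_zero_right this
  · rw [hs, coeff_dilate, map_add, coeff_mapCoeff, coeff_mul]
    simp [hy 0 zero_ne_one]
  · rw [map_add, coeff_mapCoeff, coeff_dilate, hW0, hz0]
    simp
  · rw [mul_add, key, hz', map_add, add_mul]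
    abel

end RotaBaxter

/-! ### The dendriform algebra as a bimodule over its unital associative algebra -/

section Bimodule

variable {K : Type} [Field K]

/-- The left action by `≻`. -/
noncomputable instance Dend.leftModule : Module (Unitization K (Dend K)) (Dend K) where
  smul a m := a.fst • m + Dend.succ a.snd m
  one_smul m := by
    change (1 : K) • m + Dend.succ 0 m = m
    simp
  mul_smul a b m := by
    change (a.fst * b.fst) • m + Dend.succ (a.fst • b.snd + b.fst • a.snd + a.snd * b.snd) m =
      a.fst • (b.fst • m + Dend.succ b.snd m) +
        Dend.succ a.snd (b.fst • m + Dend.succ b.snd m)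
    simp only [Dend.mul_def, map_add, map_smul, LinearMap.add_apply, LinearMap.smul_apply,
      Dend.succ_succ]
    module
  smul_zero a := by
    change a.fst • (0 : Dend K) + Dend.succ a.snd 0 = 0
    simp
  smul_add a m n := by
    change a.fst • (m + n) + Dend.succ a.snd (m + n) =
      (a.fst • m + Dend.succ a.snd m) + (a.fst • n + Dend.succ a.snd n)
    simp only [map_add, smul_add]; abel
  add_smul a b m := by
    change (a.fst + b.fst) • m + Dend.succ (a.snd + b.snd) m =
      (a.fst • m + Dend.succ a.snd m) + (b.fst • m + Dend.succ b.snd m)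
    simp only [map_add, LinearMap.add_apply, add_smul]; abel
  zero_smul m := by
    change (0 : K) • m + Dend.succ 0 m = 0
    simp

theorem Dend.smul_def (a : Unitization K (Dend K)) (m : Dend K) :
    a • m = a.fst • m + Dend.succ a.snd m := rfl

/-- The right action by `≺`. -/
noncomputable instance Dend.rightModule : Module (Unitization K (Dend K))ᵐᵒᵖ (Dend K) where
  smul a m := a.unop.fst • m + Dend.prec m a.unop.snd
  one_smul m := by
    change (1 : K) • m + Dend.prec m 0 = m
    simp
  mul_smul a b m := by
    change (b.unop.fst * a.unop.fst) • m + Dend.prec m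
        (b.unop.fst • a.unop.snd + a.unop.fst • b.unop.snd + b.unop.snd * a.unop.snd) =
      a.unop.fst • (b.unop.fst • m + Dend.prec m b.unop.snd) +
        Dend.prec (b.unop.fst • m + Dend.prec m b.unop.snd) a.unop.snd
    simp only [Dend.mul_def, map_add, map_smul, LinearMap.add_apply, LinearMap.smul_apply,
      ← Dend.prec_prec]
    module
  smul_zero a := by
    change a.unop.fst • (0 : Dend K) + Dend.prec 0 a.unop.snd = 0
    simp
  smul_add a m n := by
    change a.unop.fst • (m + n) + Dend.prec (m + n) a.unop.snd =
      (a.unop.fst • m + Dend.prec m a.unop.snd) + (a.unop.fst • n + Dend.prec n a.unop.snd)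
    simp only [map_add, LinearMap.add_apply, smul_add]; abel
  add_smul a b m := by
    change (a.unop.fst + b.unop.fst) • m + Dend.prec m (a.unop.snd + b.unop.snd) =
      (a.unop.fst • m + Dend.prec m a.unop.snd) + (b.unop.fst • m + Dend.prec m b.unop.snd)
    simp only [map_add, add_smul]; abel
  zero_smul m := by
    change (0 : K) • m + Dend.prec m 0 = 0
    simp

theorem Dend.op_smul_def (a : Unitization K (Dend K)) (m : Dend K) :
    MulOpposite.op a • m = a.fst • m + Dend.prec m a.snd := rfl

/-- The middle dendriform axiom. The other two are the associativity of the two actions, so `Dend`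
is a bimodule and the square-zero extension below is a ring. -/
instance Dend.smulCommClass :
    SMulCommClass (Unitization K (Dend K)) (Unitization K (Dend K))ᵐᵒᵖ (Dend K) where
  smul_comm a b m := by
    induction b using MulOpposite.rec' with
    | _ b =>
    simp only [Dend.smul_def, Dend.op_smul_def, map_add, map_smul, LinearMap.add_apply,
      LinearMap.smul_apply, Dend.succ_prec]
    module

instance Dend.isScalarTower : IsScalarTower K (Unitization K (Dend K)) (Dend K) where
  smul_assoc c a m := by
    simp only [Dend.smul_def, Unitization.fst_smul, Unitization.snd_smul, map_smul,
      LinearMap.smul_apply, smul_eq_mul]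
    module

instance Dend.isScalarTower_op : IsScalarTower K (Unitization K (Dend K))ᵐᵒᵖ (Dend K) where
  smul_assoc c a m := by
    induction a using MulOpposite.rec' with
    | _ a =>
    rw [← MulOpposite.op_smul]
    simp only [Dend.op_smul_def, Unitization.fst_smul, Unitization.snd_smul, map_smul,
      smul_eq_mul]
    module

variable (K) in
/-- The trivial square zero extension of `Dend` with a unit by the bimodule `Dend`. -/
abbrev DendExt : Type := TrivSqZeroExt (Unitization K (Dend K)) (Dend K)

variable (K) in
/-- The Rota–Baxter operator on `DendExt` that maps the copy of `Dend` in the bimodule to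
the copy in the algebra. -/
noncomputable def DendExt.R : DendExt K →ₗ[K] DendExt K where
  toFun x := TrivSqZeroExt.inl (x.snd : Unitization K (Dend K))
  map_add' x y := by simp
  map_smul' c x := by
    ext <;> simp

theorem DendExt.R_inr (m : Dend K) :
    DendExt.R K (TrivSqZeroExt.inr m) = TrivSqZeroExt.inl (m : Unitization K (Dend K)) := rfl

/-- The bimodule component of `x R(y) + R(x) y` is the sum of the `≺` and `≻` products of the
components of `x` and `y`, that is, their associative product. -/
theorem DendExt.isRotaBaxter : IsRotaBaxter (DendExt.R K) := by
  intro x y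
  change TrivSqZeroExt.inl (x.snd : Unitization K (Dend K)) *
    TrivSqZeroExt.inl (y.snd : Unitization K (Dend K)) = TrivSqZeroExt.inl _
  rw [← TrivSqZeroExt.inl_mul, ← Unitization.inr_mul]
  congr 2
  simp [DendExt.R, Dend.mul_def, Dend.smul_def, Dend.op_smul_def, add_comm]

end Bimodule

/-! ### Series of rooted trees as series of planar binary trees -/

section Comparison

variable {K : Type} [Field K]

theorem phi_vertex : phi K PL.vertex = Dend.Y :=
  (PL.existsUnique_hom (K := K) Dend.preLie Dend.preLie_axiom Dend.Y).choose_spec.1.1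

theorem phi_graft (x y : PL K) : phi K (PL.graft x y) = Dend.preLie (phi K x) (phi K y) :=
  (PL.existsUnique_hom (K := K) Dend.preLie Dend.preLie_axiom Dend.Y).choose_spec.1.2 x y

/-- The generating series of the images of the components under `phi`. -/
noncomputable def phiSeries (A : PLhat K) : (DendExt K)⟦X⟧ :=
  PowerSeries.mk fun n => TrivSqZeroExt.inr (phi K (A n))

theorem coeff_phiSeries (A : PLhat K) (n : ℕ) :
    coeff n (phiSeries A) = TrivSqZeroExt.inr (phi K (A n)) := coeff_mk _ _

theorem coeff_zero_phiSeries (A : PLhat K) : coeff 0 (phiSeries A) = 0 := by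
  rw [coeff_phiSeries, PLhat.zero_eq (A 0)]
  simp

theorem phiSeries_add (A C : PLhat K) : phiSeries (A + C) = phiSeries A + phiSeries C := by
  ext n : 1
  simp [coeff_phiSeries]

theorem phiSeries_sub (A C : PLhat K) : phiSeries (A - C) = phiSeries A - phiSeries C := by
  ext n : 1
  simp [coeff_phiSeries]

theorem phiSeries_smul (c : K) (A : PLhat K) : phiSeries (c • A) = c • phiSeries A := by
  ext n : 1
  simp [coeff_phiSeries]

theorem phiSeries_shift (c : K) (A : PLhat K) :
    phiSeries (PLhat.shift c A) = dilate c (phiSeries A) := by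
  ext n : 1
  simp [coeff_phiSeries, coeff_dilate, PLhat.shift]

/-- In `DendExt`, `y ≻ x` is `R(y) x` and `x ≺ y` is `x R(y)`, so the pre-Lie product is a
commutator. -/
theorem phiSeries_graft (A C : PLhat K) :
    phiSeries (PLhat.graft A C) = adj K (mapCoeff (DendExt.R K) (phiSeries C)) (phiSeries A) := by
  ext n : 1
  rw [adj_apply, map_sub, coeff_mul, coeff_mul,
    ← Finset.Nat.sum_antidiagonal_swap, ← Finset.sum_sub_distrib]
  simp only [coeff_mapCoeff, coeff_phiSeries, DendExt.R_inr, PLhat.graft, map_sum,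
    TrivSqZeroExt.inl_mul_inr, TrivSqZeroExt.inr_mul_inl, phi_graft]
  rw [← TrivSqZeroExt.inrHom_apply (R := Unitization K (Dend K)), map_sum]
  refine Finset.sum_congr rfl fun p _ => ?_
  simp [Dend.smul_def, Dend.op_smul_def, Dend.preLie_apply, TrivSqZeroExt.inr_sub]

theorem phiSeries_act (f : K⟦X⟧) (A x : PLhat K) :
    phiSeries (PLhat.act f A x) =
      opEval f (adj K (mapCoeff (DendExt.R K) (phiSeries A))) (phiSeries x) := by
  have h (k : ℕ) : phiSeries ((fun z => PLhat.graft z A)^[k] x) =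
      (adj K (mapCoeff (DendExt.R K) (phiSeries A)) ^ k) (phiSeries x) := by
    induction k with
    | zero => simp
    | succ k ih =>
      rw [Function.iterate_succ_apply', phiSeries_graft, ih, pow_succ', Module.End.mul_apply]
  ext n : 1
  -- Both definitions cut the sum at `k ≤ n` in degree `n`, so the comparison is term by term.
  rw [opEval, seriesSum, coeff_mk, coeff_phiSeries, PLhat.act, AddSubmonoidClass.coe_finsetSum,
    map_sum, ← TrivSqZeroExt.inrHom_apply (R := Unitization K (Dend K)), map_sum]
  refine Finset.sum_congr rfl fun k _ => ?_
  rw [← h, coeff_smul, coeff_phiSeries]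
  simp

theorem coeff_phiSeries_vertex (n : ℕ) (hn : n ≠ 1) :
    coeff n (phiSeries (PLhat.vertex : PLhat K)) = 0 := by
  rw [coeff_phiSeries, PLhat.vertex, Pi.single_eq_of_ne hn]
  simp

theorem coeff_one_phiSeries_vertex :
    coeff 1 (phiSeries (PLhat.vertex : PLhat K)) = TrivSqZeroExt.inr Dend.Y := by
  rw [coeff_phiSeries, PLhat.vertex, Pi.single_eq_same, phi_vertex]

/-! ### Noncommutative symmetric functions -/

/-- The generating series of the images under `theta`. -/
noncomputable def thetaSeries (u : ℕ → Sym K) : (DendExt K)⟦X⟧ :=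
  PowerSeries.mk fun n => TrivSqZeroExt.inl (theta K (u n))

theorem coeff_thetaSeries (u : ℕ → Sym K) (n : ℕ) :
    coeff n (thetaSeries u) = TrivSqZeroExt.inl (theta K (u n)) := coeff_mk _ _

theorem theta_S_succ (n : ℕ) :
    theta K (Sym.S K (n + 1)) = (leftComb K n : Unitization K (Dend K)) := by
  simp [theta, Sym.S]

/-- The recursion `L_{n+1} = Lₙ ≻ Y` in generating form; `phiSeries PLhat.vertex` lives in degree
one, so only the pair `(n, 1)` contributes. -/
theorem thetaSeries_S : thetaSeries (Sym.S K) =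
    1 + mapCoeff (DendExt.R K) (thetaSeries (Sym.S K) * phiSeries PLhat.vertex) := by
  ext n : 1
  rw [map_add, coeff_mapCoeff, coeff_mul]
  rcases n with _ | n
  · simp [coeff_thetaSeries, coeff_zero_phiSeries, Sym.S]
  rw [Finset.sum_eq_single (n, 1)]
  · rw [coeff_one_phiSeries_vertex, coeff_thetaSeries, coeff_thetaSeries, coeff_one,
      if_neg n.succ_ne_zero, zero_add, TrivSqZeroExt.inl_mul_inr, DendExt.R_inr, theta_S_succ]
    congr 2
    -- `L₀ = 1` lies in the scalar part of the unitization, not among the `leftComb`s, so it acts on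
    -- `Y` separately.
    rcases n with _ | n
    · simp [Sym.S, leftComb]
    · rw [theta_S_succ, Dend.smul_def]
      simp [leftComb]
  · intro p hp hne
    have := HasAntidiagonal.mem_antidiagonal.1 hp
    rw [coeff_phiSeries_vertex p.2 fun h => hne (Prod.ext (show p.1 = n by omega) h), mul_zero]
  · simp

/-- The image of `Sym.PsiQ_eq` times `1 - q`; its last sum is `n Sₙ` by the definition of `Ψ`, which
gives the Euler term. -/
theorem thetaSeries_PsiQ {q : K} (hq : ∀ n : ℕ, 0 < n → q ^ n ≠ 1) :
    thetaSeries (Sym.S K) * thetaSeries (fun n => (1 - q) • Sym.PsiQ q n) =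
      dilate q (thetaSeries fun n => (1 - q) • Sym.PsiQ q n) * thetaSeries (Sym.S K) +
        (1 - q) • euler K (thetaSeries (Sym.S K)) := by
  ext n : 1
  have h := Sym.PsiQ_eq hq n
  have hS : ∑ p ∈ HasAntidiagonal.antidiagonal n, Sym.S K p.1 * Sym.Psi K p.2 =
      (n : K) • Sym.S K n := by
    rw [Sym.smul_S, Finset.Nat.sum_antidiagonal_eq_sum_range_succ
      (fun i j => Sym.S K i * Sym.Psi K j), Finset.sum_range_succ, Nat.sub_self, Sym.Psi_zero,
      mul_zero, add_zero]
  rw [hS] at h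
  have h' := congrArg (fun u => (TrivSqZeroExt.inlAlgHom K (Unitization K (Dend K)) (Dend K))
    (theta K ((1 - q) • u))) h
  simp only [smul_add, Finset.smul_sum, map_add, map_sum, map_smul, map_mul,
    TrivSqZeroExt.inlAlgHom_apply] at h'
  simp only [map_add, coeff_mul, coeff_thetaSeries, coeff_dilate, coeff_smul, coeff_euler, map_smul,
    TrivSqZeroExt.inl_smul, mul_smul_comm, smul_mul_assoc]
  simp only [smul_comm (q ^ _) (1 - q)]
  exact h'

end Comparison

end QOmega

theorem mainTheorem1 (n : ℕ) (hn : 1 ≤ n) :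
    QOmega.theta QOmega.Qq ((1 - QOmega.q) • QOmega.Sym.PsiQ QOmega.q n) =
      ((QOmega.phi QOmega.Qq (QOmega.PLhat.suspension QOmega.OmegaQ n) :
        QOmega.Dend QOmega.Qq) : Unitization QOmega.Qq (QOmega.Dend QOmega.Qq)) := by
  open QOmega in
  have hO : PLhat.act (bernoulliPowerSeries Qq) (Omega Qq) PLhat.vertex = Omega Qq :=
    (existsUnique_Omega Qq).choose_spec.1
  have hQ := (existsUnique_OmegaQ q_pow_ne_one).choose_spec.1
  change PLhat.act (PowerSeries.exp Qq - 1) (Omega Qq) (PLhat.shift q OmegaQ) +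
    PLhat.shift q OmegaQ - OmegaQ = PLhat.graft PLhat.vertex OmegaQ + (q - 1) • PLhat.vertex at hQ
  replace hO := congrArg phiSeries hO
  replace hQ := congrArg phiSeries hQ
  simp only [phiSeries_act, phiSeries_add, phiSeries_sub, phiSeries_shift, phiSeries_graft,
    phiSeries_smul] at hO hQ
  have h := DendExt.isRotaBaxter.eq_neg_dilate q_pow_ne_one coeff_phiSeries_vertex
    (coeff_zero_phiSeries _) (coeff_zero_phiSeries _)
    (by simp [coeff_thetaSeries, Sym.PsiQ, Sym.Psi_zero]) hO hQ thetaSeries_S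
    (thetaSeries_PsiQ q_pow_ne_one)
  -- Both series have coefficients in the algebra part; the sign `-(-1)ⁿ` becomes the `(-1)ⁿ⁺¹` of
  -- the suspension.
  have h' := congrArg (fun u => (PowerSeries.coeff n u).fst) h
  simp only [coeff_thetaSeries, map_neg, coeff_dilate, coeff_mapCoeff, coeff_phiSeries,
    DendExt.R_inr, TrivSqZeroExt.fst_inl, TrivSqZeroExt.fst_neg, TrivSqZeroExt.fst_smul] at h'
  rw [h', PLhat.suspension, Submodule.coe_smul, map_smul, Unitization.inr_smul, pow_succ,
    mul_neg_one, neg_smul]
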